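/- Lower bound for $T(f,g)$. Let $\mathcal X\subset\mathbb R^d$ be compact, equal to the closure of its interior, with connected nonempty interior (for example $[0,1]^d$), equipped with Lebesgue measure. Let $s,L>0$ and let $\Sigma(s,L)$ be the Hölder class of continuous functions on $\mathcal X$ that are $\lfloor s\rfloor$ times continuously differentiable in the interior and satisfy there $|D^rf(x)-D^rf(y)|\le L\|x-y\|^{s-|r|}$ for all multi-indices $r$ with $s-1\le|r|\le\lfloor s\rfloor$. For $-\infty\le B'<B\le\infty$ let $\mathcal D$ be the set of probability densities $f$ on $\mathcal X$ with $f\in\Sigma(s,L)$ and $B'<f<B$ (so $B'=-\infty$, $B=\infty$ gives all densities in $\Sigma(s,L)$). Let \[ T(f,g)=\phi\Big(\int_{\mathcal X}\nu(f(x),g(x))\,dx\Big),\qquad f,g\in\mathcal D, \] where $\nu$ is twice continuously differentiable on $(B',B)^2$ and $\phi$ is twice continuously differentiable on an open set containing all the values $\int\nu(f,g)$, $f,g\in\mathcal D$; suppose that $T$ is not constant on $\mathcal D\times\mathcal D$. Let $\tau=\min\{8s/(4s+d),1\}$ and $\zeta\in(0,1)$. Then there is a constant $c>0$ such that, for independent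 i.i.d. samples $X_1,\dots,X_n\sim f$ and $Y_1,\dots,Y_m\sim g$ with $m=m(n)$ and $n/(n+m)\to\zeta$ as $n\to\infty$, \[ \liminf_{n\to\infty}\ \big(n^{-\tau}+m^{-\tau}\big)^{-1}\ \inf_{\hat T}\ \sup_{f,g\in\mathcal D}\ \mathbb E_{f,g}\big[(\hat T-T(f,g))^2\big]\ \ge\ c, \] where the infimum is over all estimators, i.e. measurable real functions of the two samples. -/

import Mathlib

open MeasureTheory Filter Topology
open scoped ENNReal

noncomputable section

namespace TwoSampleLB

/-- Euclidean space `ℝ^d`. -/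
abbrev E (d : ℕ) : Type := EuclideanSpace ℝ (Fin d)

/-- The partial derivative `∂^k f / ∂x_{i 1} ⋯ ∂x_{i k}` at `x`. For a `C^k` function the order of
differentiation is irrelevant, so that the families `i : Fin k → Fin d` give exactly the
derivatives `D^r f` with `|r| = k`. -/
def partialDeriv {d : ℕ} (k : ℕ) (i : Fin k → Fin d) (f : E d → ℝ) (x : E d) : ℝ :=
  iteratedFDeriv ℝ k f x (fun j => EuclideanSpace.single (i j) (1 : ℝ))

/-- The Hölder class `Σ(s, L)` on `X`: functions that are continuous on `X`, of class `C^⌊s⌋` in the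
interior of `X`, with `|D^r f(x) - D^r f(y)| ≤ L ‖x - y‖^(s - |r|)` for all `r` with
`|r| ≤ ⌊s⌋` and `s - |r| ≤ 1`. (An exponent larger than `1` would only allow constants.) -/
def holderClass {d : ℕ} (X : Set (E d)) (s L : ℝ) : Set (E d → ℝ) :=
  {f | ContinuousOn f X ∧ ContDiffOn ℝ (⌊s⌋₊ : ℕ) f (interior X) ∧
    ∀ k : ℕ, k ≤ ⌊s⌋₊ → s - k ≤ 1 → ∀ i : Fin k → Fin d,
      ∀ x ∈ interior X, ∀ y ∈ interior X,
        |partialDeriv k i f x - partialDeriv k i f y| ≤ L * ‖x - y‖ ^ (s - k)}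

/-- The open interval of real numbers between two extended real numbers. -/
def openInterval (B' B : EReal) : Set ℝ := {t | B' < (t : EReal) ∧ (t : EReal) < B}

/-- The probability densities on `X` (with respect to Lebesgue measure) in the bounded Hölder class
`Σ(s, L, B', B) = {f ∈ Σ(s, L) : B' < f < B}`. With `B' = ⊥`, `B = ⊤` these are the densities in
`Σ(s, L)`. -/
def densityClass {d : ℕ} (X : Set (E d)) (s L : ℝ) (B' B : EReal) : Set (E d → ℝ) :=
  {f | f ∈ holderClass X s L ∧ (∀ x ∈ X, f x ∈ openInterval B' B) ∧
    (∀ x ∈ X, 0 ≤ f x) ∧ ∫ x in X, f x = 1}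

/-- The functional `T(f, g) = φ(∫_X ν(f(x), g(x)) dx)`. -/
def functional {d : ℕ} (X : Set (E d)) (φ : ℝ → ℝ) (ν : ℝ × ℝ → ℝ) (f g : E d → ℝ) : ℝ :=
  φ (∫ x in X, ν (f x, g x))

/-- The distribution on `X` with Lebesgue density `f`. -/
def law {d : ℕ} (X : Set (E d)) (f : E d → ℝ) : Measure (E d) :=
  (volume.restrict X).withDensity (fun x => ENNReal.ofReal (f x))

/-- The joint law of independent samples `X_1, …, X_n ∼ f` and `Y_1, …, Y_m ∼ g`. -/
def sampleLaw {d : ℕ} (X : Set (E d)) (n m : ℕ) (f g : E d → ℝ) :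
    Measure ((Fin n → E d) × (Fin m → E d)) :=
  (Measure.pi (fun _ : Fin n => law X f)).prod (Measure.pi (fun _ : Fin m => law X g))

/-- The mean squared error of the estimator `That` of `T(f, g)`. -/
def meanSqError {d : ℕ} (X : Set (E d)) (φ : ℝ → ℝ) (ν : ℝ × ℝ → ℝ) (n m : ℕ)
    (That : (Fin n → E d) × (Fin m → E d) → ℝ) (f g : E d → ℝ) : ℝ≥0∞ :=
  ∫⁻ z, ENNReal.ofReal ((That z - functional X φ ν f g) ^ 2) ∂(sampleLaw X n m f g)

/-- The minimax mean squared error over all estimators, that is, measurable functions of the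
data. -/
def minimaxRisk {d : ℕ} (X : Set (E d)) (s L : ℝ) (B' B : EReal) (φ : ℝ → ℝ) (ν : ℝ × ℝ → ℝ)
    (n m : ℕ) : ℝ≥0∞ :=
  ⨅ That : {h : (Fin n → E d) × (Fin m → E d) → ℝ // Measurable h},
    ⨆ f ∈ densityClass X s L B' B, ⨆ g ∈ densityClass X s L B' B,
      meanSqError X φ ν n m That.1 f g

/-- The exponent `τ = min {8s / (4s + d), 1}`. -/
def rateExponent (d : ℕ) (s : ℝ) : ℝ := min (8 * s / (4 * s + d)) 1

end TwoSampleLB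

end

/-!
The bound follows from Le Cam's method: if a pair `(f, g)` cannot be told apart from a uniform
mixture of pairs `(F l, G l)`, in the sense that the `χ²`-divergence between the laws of the data
is bounded, and if `T (F l) (G l)` exceeds `T f g` by at least `δ` for all `l` (or falls below it
by as much, for all `l`), then no estimator has a mean squared error of smaller order than `δ²`
(`le_minimaxRisk_of_mixture`). It remains to construct such pairs with `δ² ≍ n^(-τ)`.

*Room to move.* Mixing a density of the class with the uniform density makes it positive, lowers
its Hölder constant and keeps its values away from `B'` and `B`, so that every sufficiently small
perturbation of it stays in the class (`exists_isRoomy`). Since `T` is not constant, it is not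
constant among such mixtures either, and by the mean value theorem there are a pair `(f, g)` with
room to move and a direction `(u, v)` in which the derivative `φ'(∫ ν(f, g)) ∫ Dν(f, g)(u, v)` of
`T` is not zero (`exists_isRoomy_derivative_ne_zero`).

*Parametric order.* The single pair `(f + h u, g + h v)` with `h = n^(-1/2)` has bounded
divergence from `(f, g)`, and `T` moves by an amount of order `h`. This gives the order `n⁻¹`
(`exists_parametric_le_minimaxRisk`).

*Nonparametric order.* If `8 s < 4 s + d`, the curvature of `ν` yields more. As `u` and `v` have
integral zero and the interior of `X` is connected, the derivative of `T` could not be nonzero if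
`Dν` were locally constant around the values of `(f, g)`; so the Hessian of `ν` is nonzero
somewhere arbitrarily close to one of these values, and after a small perturbation at one of these
values (`exists_isRoomy_hessian_ne_zero`). Let `w` be a direction in which the second derivative
there is not zero. Near that point place `N ^ d` small groups of bumps of width `1 / N` and height
`N^(-s)`, and let `Γ l` be their sum with signs `l`. Each group consists of three bumps, so that
its coefficients can be chosen orthogonal to the constants and to the derivative of `ν` in
direction `w` (`exists_unit_orthogonal`, `exists_hypercube`). Then the perturbations
`(f + w₁ Γ l, g + w₂ Γ l)` have no first order effect on `∫ ν(f, g)`, and the second order effect is of exact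
order `N^(-2 s)`, with the same sign for all `l` (`taylor_bounds_line`). On the other hand the
mixed second moments of the likelihood ratios are at most exponentials of bilinear forms in the
signs, with coefficients of order `n N^(-2 s - d)`, and averaging over the signs turns them into
`exp (O(n² N^(-4 s - d)))` (`sum_sum_exp_sgn_le`). With `N ≍ n^(2 / (4 s + d))` this is bounded,
and `δ ≍ N^(-2 s)` gives the order `n^(-8 s / (4 s + d))` (`exists_nonparametric_le_minimaxRisk`).
-/

namespace TwoSampleLB

/-! ### Product densities and Le Cam's inequality for a mixture -/

/-- Fubini for products of functions of one coordinate each. -/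
theorem lintegral_pi_prod {α : Type*} [MeasurableSpace α] {n : ℕ} (μ : Measure α)
    [IsProbabilityMeasure μ] (p : Fin n → α → ℝ≥0∞) (hp : ∀ i, Measurable (p i)) :
    ∫⁻ x, ∏ i, p i (x i) ∂(Measure.pi fun _ : Fin n => μ) = ∏ i, ∫⁻ y, p i y ∂μ := by
  have hind := ProbabilityTheory.iIndepFun_pi (μ := fun _ : Fin n => μ) (X := fun i => p i)
    (fun i => (hp i).aemeasurable)
  have h := ProbabilityTheory.lintegral_prod_eq_prod_lintegral_of_indepFun Finset.univ
    (fun i (x : Fin n → α) => p i (x i)) hind (fun i => (hp i).comp (measurable_pi_apply i))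
  rw [h]
  refine Finset.prod_congr rfl fun i _ => ?_
  exact (measurePreserving_eval (fun _ : Fin n => μ) i).lintegral_comp (hp i)

theorem pi_withDensity {α : Type*} [MeasurableSpace α] {n : ℕ} (μ : Measure α)
    [IsProbabilityMeasure μ] (p : α → ℝ≥0∞) (hp : Measurable p)
    [IsProbabilityMeasure (μ.withDensity p)] :
    Measure.pi (fun _ : Fin n => μ.withDensity p) =
      (Measure.pi fun _ : Fin n => μ).withDensity (fun x => ∏ i, p (x i)) := by
  refine Measure.pi_eq fun s hs => ?_
  rw [withDensity_apply _ (MeasurableSet.univ_pi hs),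
    ← lintegral_indicator (MeasurableSet.univ_pi hs)]
  have : (Set.univ.pi s).indicator (fun x : Fin n → α => ∏ i, p (x i)) =
      fun x => ∏ i, (s i).indicator p (x i) := by
    classical
    funext x
    by_cases hx : x ∈ Set.univ.pi s
    · rw [Set.indicator_of_mem hx]
      exact Finset.prod_congr rfl fun i _ => (Set.indicator_of_mem (hx i trivial) _).symm
    · rw [Set.indicator_of_notMem hx]
      have : ∃ i, x i ∉ s i := by simpa [Set.mem_pi] using hx
      obtain ⟨i, hi⟩ := this
      exact (Finset.prod_eq_zero (Finset.mem_univ i) (Set.indicator_of_notMem hi _)).symm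
  rw [this, lintegral_pi_prod μ _ fun i => hp.indicator (hs i)]
  refine Finset.prod_congr rfl fun i _ => ?_
  rw [lintegral_indicator (hs i), withDensity_apply _ (hs i)]

/-- Le Cam's bound for a point hypothesis `P` against the uniform mixture of the laws with densities
`ℓ l` with respect to `P`. The sum in `hchi` is the second moment under `P` of the density of the
mixture, up to the factor `(card Λ) ^ 2`; the values `T l` all lie on the same side of `T₀`, the one
given by the sign `σ`, at distance at least `δ`. -/
theorem le_of_mixture {Ω Λ : Type*} [MeasurableSpace Ω] [Fintype Λ] [Nonempty Λ]
    (P : Measure Ω) (ℓ : Λ → Ω → ℝ) (hℓ : ∀ l, Measurable (ℓ l)) (hℓ0 : ∀ l z, 0 ≤ ℓ l z)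
    (hprob : ∀ l, ∫⁻ z, ENNReal.ofReal (ℓ l z) ∂P = 1)
    (A : ℝ) (hA : 0 < A)
    (hchi : ∑ l, ∑ l', ∫⁻ z, ENNReal.ofReal (ℓ l z * ℓ l' z) ∂P
      ≤ ENNReal.ofReal A * (Fintype.card Λ : ℝ≥0∞) ^ 2)
    (T₀ : ℝ) (T : Λ → ℝ) (δ σ : ℝ) (hδ : 0 < δ) (hσ : σ ^ 2 = 1)
    (hT : ∀ l, δ ≤ σ * (T l - T₀))
    (t : Ω → ℝ) (ht : Measurable t) (R : ℝ≥0∞)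
    (hR₀ : ∫⁻ z, ENNReal.ofReal ((t z - T₀) ^ 2) ∂P ≤ R)
    (hR : ∀ l, ∫⁻ z, ENNReal.ofReal ((t z - T l) ^ 2) * ENNReal.ofReal (ℓ l z) ∂P ≤ R) :
    ENNReal.ofReal (3 * δ ^ 2 / (16 * (1 + A))) ≤ R := by
  rcases eq_or_ne R ∞ with rfl | hRtop
  · exact le_top
  obtain ⟨r, hr, rfl⟩ : ∃ r : ℝ, 0 ≤ r ∧ R = ENNReal.ofReal r :=
    ⟨R.toReal, ENNReal.toReal_nonneg, (ENNReal.ofReal_toReal hRtop).symm⟩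
  set C : ℝ := (Fintype.card Λ : ℝ) with hC
  have hCpos : 0 < C := by rw [hC]; exact_mod_cast Fintype.card_pos
  -- If `t z` is at least `δ / 2` away from `T₀` in the direction `σ`, the first and the third
  -- term on the right suffice by the inequality between arithmetic and geometric mean. Otherwise
  -- `t z` is at least `δ / 2` away from every `T l`, and the second term suffices.
  have hpt : ∀ z, ENNReal.ofReal (δ ^ 2 / 4 * C) * ∑ l, ENNReal.ofReal (ℓ l z) ≤
      ENNReal.ofReal (A * C ^ 2) * ENNReal.ofReal ((t z - T₀) ^ 2) +
      ENNReal.ofReal C * ∑ l, ENNReal.ofReal ((t z - T l) ^ 2) * ENNReal.ofReal (ℓ l z) +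
      ENNReal.ofReal (δ ^ 2 / (16 * A)) * ∑ l, ∑ l', ENNReal.ofReal (ℓ l z * ℓ l' z) := by
    intro z
    have hmul : ∀ l, ENNReal.ofReal ((t z - T l) ^ 2) * ENNReal.ofReal (ℓ l z) =
        ENNReal.ofReal ((t z - T l) ^ 2 * ℓ l z) := fun l =>
      (ENNReal.ofReal_mul (sq_nonneg _)).symm
    have hsum0 : 0 ≤ ∑ l, ℓ l z := Finset.sum_nonneg fun l _ => hℓ0 l z
    have hsum1 : 0 ≤ ∑ l, (t z - T l) ^ 2 * ℓ l z :=
      Finset.sum_nonneg fun l _ => mul_nonneg (sq_nonneg _) (hℓ0 l z)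
    have hsq : ∑ l, ∑ l', ENNReal.ofReal (ℓ l z * ℓ l' z) =
        ENNReal.ofReal ((∑ l, ℓ l z) ^ 2) := by
      rw [sq, Finset.sum_mul_sum, ENNReal.ofReal_sum_of_nonneg
        (fun l _ => Finset.sum_nonneg fun l' _ => mul_nonneg (hℓ0 l z) (hℓ0 l' z))]
      refine Finset.sum_congr rfl fun l _ => ?_
      rw [ENNReal.ofReal_sum_of_nonneg (fun l' _ => mul_nonneg (hℓ0 l z) (hℓ0 l' z))]
    simp_rw [hmul]
    rw [hsq, ← ENNReal.ofReal_sum_of_nonneg (fun l _ => hℓ0 l z),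
      ← ENNReal.ofReal_sum_of_nonneg (fun l _ => mul_nonneg (sq_nonneg _) (hℓ0 l z)),
      ← ENNReal.ofReal_mul (by positivity), ← ENNReal.ofReal_mul (by positivity),
      ← ENNReal.ofReal_mul (by positivity), ← ENNReal.ofReal_mul (by positivity),
      ← ENNReal.ofReal_add (by positivity) (by positivity),
      ← ENNReal.ofReal_add (by positivity) (by positivity)]
    apply ENNReal.ofReal_le_ofReal
    set S := ∑ l, ℓ l z with hS
    by_cases hcase : δ / 2 ≤ σ * (t z - T₀)
    · have h1 : δ ^ 2 / 4 ≤ (t z - T₀) ^ 2 := by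
        have : (δ / 2) ^ 2 ≤ (σ * (t z - T₀)) ^ 2 := by gcongr
        rw [mul_pow, hσ] at this
        linarith
      have h2 : A * C ^ 2 * (δ ^ 2 / 4) ≤ A * C ^ 2 * (t z - T₀) ^ 2 := by gcongr
      have h3 : δ ^ 2 / 4 * C * S ≤ A * C ^ 2 * (δ ^ 2 / 4) + δ ^ 2 / (16 * A) * S ^ 2 := by
        have : A * C ^ 2 * (δ ^ 2 / 4) + δ ^ 2 / (16 * A) * S ^ 2 - δ ^ 2 / 4 * C * S
            = δ ^ 2 / (16 * A) * (2 * A * C - S) ^ 2 := by field_simp; ring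
        have : 0 ≤ δ ^ 2 / (16 * A) * (2 * A * C - S) ^ 2 := by positivity
        linarith
      have h4 : 0 ≤ C * ∑ l, (t z - T l) ^ 2 * ℓ l z := by positivity
      linarith
    · have h1 : δ ^ 2 / 4 * S ≤ ∑ l, (t z - T l) ^ 2 * ℓ l z := by
        rw [hS, Finset.mul_sum]
        refine Finset.sum_le_sum fun l _ => mul_le_mul_of_nonneg_right ?_ (hℓ0 l z)
        have h2 : δ / 2 ≤ σ * (T l - t z) := by
          have := hT l
          push Not at hcase
          nlinarith
        have : (δ / 2) ^ 2 ≤ (σ * (T l - t z)) ^ 2 := by gcongr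
        rw [mul_pow, hσ] at this
        nlinarith
      have h2 : C * (δ ^ 2 / 4 * S) ≤ C * ∑ l, (t z - T l) ^ 2 * ℓ l z := by gcongr
      have h3 : 0 ≤ A * C ^ 2 * (t z - T₀) ^ 2 := by positivity
      have h4 : 0 ≤ δ ^ 2 / (16 * A) * S ^ 2 := by positivity
      linarith
  have hint := lintegral_mono (μ := P) hpt
  rw [lintegral_add_right _ (by fun_prop), lintegral_add_right _ (by fun_prop),
    lintegral_const_mul _ (by fun_prop), lintegral_const_mul _ (by fun_prop),
    lintegral_const_mul _ (by fun_prop), lintegral_const_mul _ (by fun_prop),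
    lintegral_finsetSum _ (by fun_prop), lintegral_finsetSum _ (by fun_prop),
    lintegral_finsetSum _ (by fun_prop)] at hint
  have hswap : ∀ l, ∫⁻ z, ∑ l', ENNReal.ofReal (ℓ l z * ℓ l' z) ∂P =
      ∑ l', ∫⁻ z, ENNReal.ofReal (ℓ l z * ℓ l' z) ∂P := fun l =>
    lintegral_finsetSum _ fun l' _ => ((hℓ l).mul (hℓ l')).ennreal_ofReal
  simp_rw [hswap, hprob] at hint
  have hcard : (Fintype.card Λ : ℝ≥0∞) = ENNReal.ofReal C := by
    rw [hC, ENNReal.ofReal_natCast]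
  have hfin : ENNReal.ofReal (δ ^ 2 / 4 * C) * ENNReal.ofReal C ≤
      ENNReal.ofReal (A * C ^ 2) * ENNReal.ofReal r +
      ENNReal.ofReal C * (ENNReal.ofReal C * ENNReal.ofReal r) +
      ENNReal.ofReal (δ ^ 2 / (16 * A)) * (ENNReal.ofReal A * ENNReal.ofReal C ^ 2) := by
    have hs : ∑ l, ∫⁻ z, ENNReal.ofReal ((t z - T l) ^ 2) * ENNReal.ofReal (ℓ l z) ∂P ≤
        ENNReal.ofReal C * ENNReal.ofReal r := by
      refine (Finset.sum_le_sum fun l _ => hR l).trans ?_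
      simp [hcard]
    rw [hcard] at hchi
    calc _ = _ := by simp [hcard]
      _ ≤ _ := hint
      _ ≤ _ := by gcongr
  rw [← ENNReal.ofReal_pow hCpos.le, ← ENNReal.ofReal_mul (by positivity),
    ← ENNReal.ofReal_mul (by positivity), ← ENNReal.ofReal_mul (by positivity),
    ← ENNReal.ofReal_mul (by positivity), ← ENNReal.ofReal_mul (by positivity),
    ← ENNReal.ofReal_mul (by positivity), ← ENNReal.ofReal_add (by positivity) (by positivity),
    ← ENNReal.ofReal_add (by positivity) (by positivity),
    ENNReal.ofReal_le_ofReal_iff (by positivity)] at hfin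
  apply ENNReal.ofReal_le_ofReal
  have h1 : δ ^ 2 / (16 * A) * (A * C ^ 2) = δ ^ 2 / 16 * C ^ 2 := by field_simp
  rw [h1] at hfin
  have h2 : C ^ 2 * (3 * δ ^ 2 / 16) ≤ C ^ 2 * ((1 + A) * r) := by nlinarith
  have h3 := le_of_mul_le_mul_left h2 (by positivity)
  rw [div_le_iff₀ (by positivity)]
  linarith

/-! ### Likelihood ratios in the two-sample problem -/

variable {d : ℕ} {X : Set (E d)} {s L : ℝ} {B' B : EReal}

theorem isProbabilityMeasure_law (hX : IsCompact X) {f : E d → ℝ} (hf : ContinuousOn f X)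
    (hf0 : ∀ x ∈ X, 0 ≤ f x) (hf1 : ∫ x in X, f x = 1) : IsProbabilityMeasure (law X f) := by
  constructor
  rw [law, withDensity_apply _ MeasurableSet.univ, Measure.restrict_univ,
    ← ofReal_integral_eq_lintegral_ofReal (hf.integrableOn_compact hX)
      ((ae_restrict_iff' hX.measurableSet).2 (ae_of_all _ hf0)), hf1, ENNReal.ofReal_one]

/-- The likelihood ratio `f' / f` on `X`, extended by zero. -/
noncomputable def ratio (X : Set (E d)) (f f' : E d → ℝ) : E d → ℝ :=
  X.indicator fun x => f' x / f x

theorem measurable_ratio (hX : IsCompact X) {f f' : E d → ℝ} (hf : ContinuousOn f X)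
    (hf' : ContinuousOn f' X) (hpos : ∀ x ∈ X, 0 < f x) : Measurable (ratio X f f') := by
  classical
  have hc : ContinuousOn (fun x => f' x / f x) X := hf'.div hf fun x hx => (hpos x hx).ne'
  have := hc.measurable_piecewise (g := fun _ => (0 : ℝ)) continuousOn_const hX.measurableSet
  have e : ratio X f f' = X.piecewise (fun x => f' x / f x) fun _ => 0 :=
    (Set.piecewise_eq_indicator (f := fun x => f' x / f x)).symm
  rwa [e]

theorem ratio_nonneg {f f' : E d → ℝ} (hpos : ∀ x ∈ X, 0 < f x) (hf' : ∀ x ∈ X, 0 ≤ f' x)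
    (x : E d) : 0 ≤ ratio X f f' x :=
  Set.indicator_nonneg (fun x hx => div_nonneg (hf' x hx) (hpos x hx).le) x

theorem law_eq_withDensity_ratio (hX : IsCompact X) {f f' : E d → ℝ} (hf : ContinuousOn f X)
    (hf' : ContinuousOn f' X) (hpos : ∀ x ∈ X, 0 < f x) :
    law X f' = (law X f).withDensity fun x => ENNReal.ofReal (ratio X f f' x) := by
  rw [law, law, ← withDensity_mul₀
    (hf.aemeasurable hX.measurableSet).ennreal_ofReal
    (measurable_ratio hX hf hf' hpos).ennreal_ofReal.aemeasurable]
  refine withDensity_congr_ae ?_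
  filter_upwards [ae_restrict_mem hX.measurableSet] with x hx
  rw [Pi.mul_apply, ← ENNReal.ofReal_mul (hpos x hx).le, ratio, Set.indicator_of_mem hx,
    mul_div_cancel₀ _ (hpos x hx).ne']

theorem lintegral_ratio_mul_ratio (hX : IsCompact X) {f f' f'' : E d → ℝ}
    (hf : ContinuousOn f X) (hf' : ContinuousOn f' X) (hf'' : ContinuousOn f'' X)
    (hpos : ∀ x ∈ X, 0 < f x) (hf'0 : ∀ x ∈ X, 0 ≤ f' x) (hf''0 : ∀ x ∈ X, 0 ≤ f'' x) :
    ∫⁻ x, ENNReal.ofReal (ratio X f f' x) * ENNReal.ofReal (ratio X f f'' x) ∂(law X f) =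
      ENNReal.ofReal (∫ x in X, f' x * f'' x / f x) := by
  have hc : ContinuousOn (fun x => f' x * f'' x / f x) X :=
    (hf'.mul hf'').div hf fun x hx => (hpos x hx).ne'
  rw [law, lintegral_withDensity_eq_lintegral_mul₀
    (hf.aemeasurable hX.measurableSet).ennreal_ofReal
    (g := fun x => ENNReal.ofReal (ratio X f f' x) * ENNReal.ofReal (ratio X f f'' x))
    ((measurable_ratio hX hf hf' hpos).ennreal_ofReal.mul
      (measurable_ratio hX hf hf'' hpos).ennreal_ofReal).aemeasurable,
    ofReal_integral_eq_lintegral_ofReal (hc.integrableOn_compact hX)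
      ((ae_restrict_iff' hX.measurableSet).2 (ae_of_all _ fun x hx =>
        div_nonneg (mul_nonneg (hf'0 x hx) (hf''0 x hx)) (hpos x hx).le))]
  refine lintegral_congr_ae ?_
  filter_upwards [ae_restrict_mem hX.measurableSet] with x hx
  have := (hpos x hx).ne'
  rw [Pi.mul_apply, ← ENNReal.ofReal_mul (ratio_nonneg hpos hf'0 x),
    ← ENNReal.ofReal_mul (hpos x hx).le, ratio, ratio, Set.indicator_of_mem hx,
    Set.indicator_of_mem hx]
  congr 1
  field_simp

/-- The likelihood ratio of the two samples. -/
noncomputable def sampleRatio (X : Set (E d)) (n m : ℕ) (f g f' g' : E d → ℝ)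
    (z : (Fin n → E d) × (Fin m → E d)) : ℝ :=
  (∏ i, ratio X f f' (z.1 i)) * ∏ j, ratio X g g' (z.2 j)

theorem sampleLaw_eq_withDensity (hX : IsCompact X) (n m : ℕ) {f g f' g' : E d → ℝ}
    (hf : ContinuousOn f X) (hg : ContinuousOn g X)
    (hf' : ContinuousOn f' X) (hg' : ContinuousOn g' X)
    (hfpos : ∀ x ∈ X, 0 < f x) (hgpos : ∀ x ∈ X, 0 < g x)
    (hf'0 : ∀ x ∈ X, 0 ≤ f' x) (hg'0 : ∀ x ∈ X, 0 ≤ g' x)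
    (hf1 : ∫ x in X, f x = 1) (hg1 : ∫ x in X, g x = 1)
    (hf'1 : ∫ x in X, f' x = 1) (hg'1 : ∫ x in X, g' x = 1) :
    sampleLaw X n m f' g' = (sampleLaw X n m f g).withDensity
      fun z => ENNReal.ofReal (sampleRatio X n m f g f' g' z) := by
  have := isProbabilityMeasure_law hX hf (fun x hx => (hfpos x hx).le) hf1
  have := isProbabilityMeasure_law hX hg (fun x hx => (hgpos x hx).le) hg1
  have p1 := isProbabilityMeasure_law hX hf' hf'0 hf'1
  have p2 := isProbabilityMeasure_law hX hg' hg'0 hg'1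
  have e1 := law_eq_withDensity_ratio hX hf hf' hfpos
  have e2 := law_eq_withDensity_ratio hX hg hg' hgpos
  have m1 := (measurable_ratio hX hf hf' hfpos).ennreal_ofReal
  have m2 := (measurable_ratio hX hg hg' hgpos).ennreal_ofReal
  rw [e1] at p1
  rw [e2] at p2
  rw [sampleLaw, e1, e2, pi_withDensity _ _ m1, pi_withDensity _ _ m2,
    prod_withDensity (f := fun x : Fin n → E d => ∏ i, ENNReal.ofReal (ratio X f f' (x i)))
      (g := fun x : Fin m → E d => ∏ i, ENNReal.ofReal (ratio X g g' (x i)))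
      (Finset.measurable_prod _ fun i _ => m1.comp (measurable_pi_apply i))
      (Finset.measurable_prod _ fun i _ => m2.comp (measurable_pi_apply i)), sampleLaw]
  congr 1
  funext z
  rw [sampleRatio, ENNReal.ofReal_mul (Finset.prod_nonneg fun i _ => ratio_nonneg hfpos hf'0 _),
    ENNReal.ofReal_prod_of_nonneg (fun i _ => ratio_nonneg hfpos hf'0 _),
    ENNReal.ofReal_prod_of_nonneg (fun i _ => ratio_nonneg hgpos hg'0 _)]

theorem lintegral_sampleRatio_mul (hX : IsCompact X) (n m : ℕ) {f g f' g' f'' g'' : E d → ℝ}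
    (hf : ContinuousOn f X) (hg : ContinuousOn g X)
    (hf' : ContinuousOn f' X) (hg' : ContinuousOn g' X)
    (hf'' : ContinuousOn f'' X) (hg'' : ContinuousOn g'' X)
    (hfpos : ∀ x ∈ X, 0 < f x) (hgpos : ∀ x ∈ X, 0 < g x)
    (hf'0 : ∀ x ∈ X, 0 ≤ f' x) (hg'0 : ∀ x ∈ X, 0 ≤ g' x)
    (hf''0 : ∀ x ∈ X, 0 ≤ f'' x) (hg''0 : ∀ x ∈ X, 0 ≤ g'' x)
    (hf1 : ∫ x in X, f x = 1) (hg1 : ∫ x in X, g x = 1) :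
    ∫⁻ z, ENNReal.ofReal (sampleRatio X n m f g f' g' z * sampleRatio X n m f g f'' g'' z)
      ∂(sampleLaw X n m f g) =
      ENNReal.ofReal ((∫ x in X, f' x * f'' x / f x) ^ n * (∫ x in X, g' x * g'' x / g x) ^ m) := by
  have := isProbabilityMeasure_law hX hf (fun x hx => (hfpos x hx).le) hf1
  have := isProbabilityMeasure_law hX hg (fun x hx => (hgpos x hx).le) hg1
  have m1 := measurable_ratio hX hf hf' hfpos
  have m2 := measurable_ratio hX hg hg' hgpos
  have m1' := measurable_ratio hX hf hf'' hfpos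
  have m2' := measurable_ratio hX hg hg'' hgpos
  have n1 := ratio_nonneg hfpos hf'0
  have n2 := ratio_nonneg hgpos hg'0
  have n1' := ratio_nonneg hfpos hf''0
  have n2' := ratio_nonneg hgpos hg''0
  have key : ∀ z : (Fin n → E d) × (Fin m → E d),
      ENNReal.ofReal (sampleRatio X n m f g f' g' z * sampleRatio X n m f g f'' g'' z) =
      (∏ i, (ENNReal.ofReal (ratio X f f' (z.1 i)) * ENNReal.ofReal (ratio X f f'' (z.1 i)))) *
      ∏ j, (ENNReal.ofReal (ratio X g g' (z.2 j)) * ENNReal.ofReal (ratio X g g'' (z.2 j))) := by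
    intro z
    have e : sampleRatio X n m f g f' g' z * sampleRatio X n m f g f'' g'' z =
      (∏ i, (ratio X f f' (z.1 i) * ratio X f f'' (z.1 i))) *
      ∏ j, (ratio X g g' (z.2 j) * ratio X g g'' (z.2 j)) := by
      rw [sampleRatio, sampleRatio, Finset.prod_mul_distrib, Finset.prod_mul_distrib]
      ring
    rw [e, ENNReal.ofReal_mul (Finset.prod_nonneg fun i _ => mul_nonneg (n1 _) (n1' _)),
      ENNReal.ofReal_prod_of_nonneg (fun i _ => mul_nonneg (n1 _) (n1' _)),
      ENNReal.ofReal_prod_of_nonneg (fun i _ => mul_nonneg (n2 _) (n2' _))]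
    congr 1
    · exact Finset.prod_congr rfl fun i _ => ENNReal.ofReal_mul (n1 _)
    · exact Finset.prod_congr rfl fun i _ => ENNReal.ofReal_mul (n2 _)
  have q : ∀ {f f' f'' : E d → ℝ}, (∀ x ∈ X, 0 < f x) → (∀ x ∈ X, 0 ≤ f' x) →
      (∀ x ∈ X, 0 ≤ f'' x) → 0 ≤ ∫ x in X, f' x * f'' x / f x := fun h h' h'' =>
    setIntegral_nonneg hX.measurableSet fun x hx =>
      div_nonneg (mul_nonneg (h' x hx) (h'' x hx)) (h x hx).le
  simp_rw [key]
  rw [sampleLaw, lintegral_prod_mul (f := fun x : Fin n → E d => ∏ i,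
      (ENNReal.ofReal (ratio X f f' (x i)) * ENNReal.ofReal (ratio X f f'' (x i))))
      (g := fun x : Fin m → E d => ∏ i,
      (ENNReal.ofReal (ratio X g g' (x i)) * ENNReal.ofReal (ratio X g g'' (x i))))
      (Measurable.aemeasurable (by fun_prop)) (Measurable.aemeasurable (by fun_prop)),
    lintegral_pi_prod _ (fun _ x => ENNReal.ofReal (ratio X f f' x) *
      ENNReal.ofReal (ratio X f f'' x)) (fun _ => by fun_prop),
    lintegral_pi_prod _ (fun _ x => ENNReal.ofReal (ratio X g g' x) *
      ENNReal.ofReal (ratio X g g'' x)) (fun _ => by fun_prop),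
    lintegral_ratio_mul_ratio hX hf hf' hf'' hfpos hf'0 hf''0,
    lintegral_ratio_mul_ratio hX hg hg' hg'' hgpos hg'0 hg''0,
    ENNReal.ofReal_mul (pow_nonneg (q hfpos hf'0 hf''0) _),
    ENNReal.ofReal_pow (q hfpos hf'0 hf''0), ENNReal.ofReal_pow (q hgpos hg'0 hg''0)]
  simp

/-- Le Cam's method of fuzzy hypotheses for the two-sample problem: if the `χ²`-divergence from the
law under `(f, g)` to the uniform mixture of the laws under `(F l, G l)` is bounded, and the
functional moves by at least `δ` in a common direction, then the minimax risk is of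
order `δ²`. -/
theorem le_minimaxRisk_of_mixture (hX : IsCompact X) {φ : ℝ → ℝ} {ν : ℝ × ℝ → ℝ} {n m : ℕ}
    {Λ : Type*} [Fintype Λ] [Nonempty Λ] {f g : E d → ℝ} {F G : Λ → E d → ℝ}
    (hf : f ∈ densityClass X s L B' B) (hg : g ∈ densityClass X s L B' B)
    (hF : ∀ l, F l ∈ densityClass X s L B' B) (hG : ∀ l, G l ∈ densityClass X s L B' B)
    (hfpos : ∀ x ∈ X, 0 < f x) (hgpos : ∀ x ∈ X, 0 < g x) {A : ℝ} (hA : 0 < A)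
    (hchi : ∑ l, ∑ l', (∫ x in X, F l x * F l' x / f x) ^ n * (∫ x in X, G l x * G l' x / g x) ^ m
      ≤ A * (Fintype.card Λ : ℝ) ^ 2)
    {δ σ : ℝ} (hδ : 0 < δ) (hσ : σ ^ 2 = 1)
    (hT : ∀ l, δ ≤ σ * (functional X φ ν (F l) (G l) - functional X φ ν f g)) :
    ENNReal.ofReal (3 * δ ^ 2 / (16 * (1 + A))) ≤ minimaxRisk X s L B' B φ ν n m := by
  refine le_iInf fun That => ?_
  have hfc := hf.1.1
  have hgc := hg.1.1
  have hmeas : ∀ l, Measurable (sampleRatio X n m f g (F l) (G l)) := by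
    intro l
    have m1 := measurable_ratio hX hfc (hF l).1.1 hfpos
    have m2 := measurable_ratio hX hgc (hG l).1.1 hgpos
    unfold sampleRatio
    fun_prop
  have hwd : ∀ l, sampleLaw X n m (F l) (G l) = (sampleLaw X n m f g).withDensity
      fun z => ENNReal.ofReal (sampleRatio X n m f g (F l) (G l) z) := fun l =>
    sampleLaw_eq_withDensity hX n m hfc hgc (hF l).1.1 (hG l).1.1 hfpos hgpos (hF l).2.2.1
      (hG l).2.2.1 hf.2.2.2 hg.2.2.2 (hF l).2.2.2 (hG l).2.2.2
  have hq : ∀ l l', 0 ≤ (∫ x in X, F l x * F l' x / f x) ^ n *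
      (∫ x in X, G l x * G l' x / g x) ^ m := fun l l' =>
    mul_nonneg (pow_nonneg (setIntegral_nonneg hX.measurableSet fun x hx =>
      div_nonneg (mul_nonneg ((hF l).2.2.1 x hx) ((hF l').2.2.1 x hx)) (hfpos x hx).le) _)
      (pow_nonneg (setIntegral_nonneg hX.measurableSet fun x hx =>
      div_nonneg (mul_nonneg ((hG l).2.2.1 x hx) ((hG l').2.2.1 x hx)) (hgpos x hx).le) _)
  refine le_of_mixture (sampleLaw X n m f g) (fun l => sampleRatio X n m f g (F l) (G l)) hmeas
    (fun l z => mul_nonneg (Finset.prod_nonneg fun i _ => ratio_nonneg hfpos (hF l).2.2.1 _)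
      (Finset.prod_nonneg fun i _ => ratio_nonneg hgpos (hG l).2.2.1 _)) ?_ A hA ?_
    (functional X φ ν f g) (fun l => functional X φ ν (F l) (G l)) δ σ hδ hσ hT That.1 That.2 _
    ?_ ?_
  · intro l
    have := isProbabilityMeasure_law hX (hF l).1.1 (hF l).2.2.1 (hF l).2.2.2
    have := isProbabilityMeasure_law hX (hG l).1.1 (hG l).2.2.1 (hG l).2.2.2
    have h1 : sampleLaw X n m (F l) (G l) Set.univ = 1 := by
      rw [sampleLaw]; exact measure_univ
    rwa [hwd l, withDensity_apply _ MeasurableSet.univ, Measure.restrict_univ] at h1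
  · simp_rw [lintegral_sampleRatio_mul hX n m hfc hgc (hF _).1.1 (hG _).1.1 (hF _).1.1 (hG _).1.1
      hfpos hgpos (hF _).2.2.1 (hG _).2.2.1 (hF _).2.2.1 (hG _).2.2.1 hf.2.2.2 hg.2.2.2]
    have : ∀ l, ∑ l', ENNReal.ofReal ((∫ x in X, F l x * F l' x / f x) ^ n *
        (∫ x in X, G l x * G l' x / g x) ^ m) = ENNReal.ofReal (∑ l',
        (∫ x in X, F l x * F l' x / f x) ^ n * (∫ x in X, G l x * G l' x / g x) ^ m) := fun l =>
      (ENNReal.ofReal_sum_of_nonneg fun l' _ => hq l l').symm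
    simp_rw [this]
    rw [← ENNReal.ofReal_sum_of_nonneg fun l _ => Finset.sum_nonneg fun l' _ => hq l l']
    refine (ENNReal.ofReal_le_ofReal hchi).trans ?_
    rw [ENNReal.ofReal_mul hA.le, ENNReal.ofReal_pow (by positivity), ENNReal.ofReal_natCast]
  · exact le_iSup₂_of_le f hf (le_iSup₂_of_le g hg le_rfl)
  · intro l
    refine le_trans (le_of_eq ?_) (le_iSup₂_of_le (F l) (hF l) (le_iSup₂_of_le (G l) (hG l) le_rfl))
    rw [meanSqError, hwd l, lintegral_withDensity_eq_lintegral_mul _ (hmeas l).ennreal_ofReal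
      (((That.2.sub_const _).pow_const 2).ennreal_ofReal)]
    refine lintegral_congr fun z => ?_
    rw [Pi.mul_apply, mul_comm]

/-! ### Convexity of the density class, perturbations and room -/

theorem isOpen_openInterval (B' B : EReal) : IsOpen (openInterval B' B) :=
  (isOpen_Ioi.preimage continuous_coe_real_ereal).inter
    (isOpen_Iio.preimage continuous_coe_real_ereal)

theorem ordConnected_openInterval (B' B : EReal) : (openInterval B' B).OrdConnected := by
  refine ⟨fun a ha b hb t ht => ⟨ha.1.trans_le ?_, lt_of_le_of_lt ?_ hb.2⟩⟩
  · exact_mod_cast ht.1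
  · exact_mod_cast ht.2

theorem partialDeriv_add {k : ℕ} (i : Fin k → Fin d) {f g : E d → ℝ} {x : E d}
    (hf : ContDiffAt ℝ k f x) (hg : ContDiffAt ℝ k g x) :
    partialDeriv k i (fun y => f y + g y) x = partialDeriv k i f x + partialDeriv k i g x := by
  unfold partialDeriv
  rw [show (fun y => f y + g y) = f + g from rfl, iteratedFDeriv_add_apply hf hg]
  rfl

theorem partialDeriv_const_mul {k : ℕ} (i : Fin k → Fin d) (a : ℝ) {f : E d → ℝ} {x : E d}
    (hf : ContDiffAt ℝ k f x) :
    partialDeriv k i (fun y => a * f y) x = a * partialDeriv k i f x := by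
  unfold partialDeriv
  rw [show (fun y => a * f y) = a • f from rfl, iteratedFDeriv_const_smul_apply hf]
  rfl

theorem partialDeriv_const {k : ℕ} (i : Fin k → Fin d) (a : ℝ) (x y : E d) :
    partialDeriv k i (fun _ => a) x = partialDeriv k i (fun _ => a) y := by
  unfold partialDeriv
  rcases Nat.eq_zero_or_pos k with rfl | hk
  · simp
  · rw [iteratedFDeriv_const_of_ne hk.ne']
    simp

theorem contDiffAt_of_mem_holderClass {f : E d → ℝ} (hf : f ∈ holderClass X s L) {k : ℕ}
    (hk : k ≤ ⌊s⌋₊) {x : E d} (hx : x ∈ interior X) : ContDiffAt ℝ k f x :=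
  (hf.2.1.contDiffAt (isOpen_interior.mem_nhds hx)).of_le (by exact_mod_cast hk)

/-- The Hölder constant of a combination is the combination of the Hölder constants. In particular
mixing with a constant lowers it. -/
theorem holderClass_combo {L₀ L₁ a b : ℝ} (ha : 0 ≤ a) (hb : 0 ≤ b) {f g : E d → ℝ}
    (hf : f ∈ holderClass X s L₀) (hg : g ∈ holderClass X s L₁) (hL : a * L₀ + b * L₁ ≤ L) :
    (fun x => a * f x + b * g x) ∈ holderClass X s L := by
  refine ⟨(hf.1.const_mul a).add (hg.1.const_mul b),
    (contDiffOn_const.mul hf.2.1).add (contDiffOn_const.mul hg.2.1), ?_⟩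
  intro k hk hsk i x hx y hy
  have e : ∀ z ∈ interior X, partialDeriv k i (fun x => a * f x + b * g x) z =
      a * partialDeriv k i f z + b * partialDeriv k i g z := by
    intro z hz
    have h1 := contDiffAt_of_mem_holderClass hf hk hz
    have h2 := contDiffAt_of_mem_holderClass hg hk hz
    rw [partialDeriv_add i (contDiffAt_const.mul h1) (contDiffAt_const.mul h2),
      partialDeriv_const_mul i a h1, partialDeriv_const_mul i b h2]
  have h1 := hf.2.2 k hk hsk i x hx y hy
  have h2 := hg.2.2 k hk hsk i x hx y hy
  rw [e x hx, e y hy]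
  have hp : 0 ≤ ‖x - y‖ ^ (s - k) := by positivity
  calc |a * partialDeriv k i f x + b * partialDeriv k i g x -
        (a * partialDeriv k i f y + b * partialDeriv k i g y)|
      = |a * (partialDeriv k i f x - partialDeriv k i f y) +
        b * (partialDeriv k i g x - partialDeriv k i g y)| := by ring_nf
    _ ≤ a * |partialDeriv k i f x - partialDeriv k i f y| +
        b * |partialDeriv k i g x - partialDeriv k i g y| := by
      refine (abs_add_le _ _).trans ?_
      rw [abs_mul, abs_mul, abs_of_nonneg ha, abs_of_nonneg hb]
    _ ≤ a * (L₀ * ‖x - y‖ ^ (s - k)) + b * (L₁ * ‖x - y‖ ^ (s - k)) := by gcongr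
    _ = (a * L₀ + b * L₁) * ‖x - y‖ ^ (s - k) := by ring
    _ ≤ L * ‖x - y‖ ^ (s - k) := by gcongr

theorem densityClass_combo (hX : IsCompact X) {a b : ℝ} (ha : 0 ≤ a) (hb : 0 ≤ b) (hab : a + b = 1)
    {f g : E d → ℝ} (hf : f ∈ densityClass X s L B' B) (hg : g ∈ densityClass X s L B' B) :
    (fun x => a * f x + b * g x) ∈ densityClass X s L B' B := by
  refine ⟨holderClass_combo ha hb hf.1 hg.1 (by rw [← add_mul, hab, one_mul]), fun x hx => ?_,
    fun x hx => add_nonneg (mul_nonneg ha (hf.2.2.1 x hx)) (mul_nonneg hb (hg.2.2.1 x hx)), ?_⟩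
  · exact (ordConnected_openInterval B' B).convex (hf.2.1 x hx) (hg.2.1 x hx) ha hb hab
  · rw [integral_add ((hf.1.1.const_mul a).integrableOn_compact hX)
      ((hg.1.1.const_mul b).integrableOn_compact hX), integral_const_mul, integral_const_mul,
      hf.2.2.2, hg.2.2.2, mul_one, mul_one, hab]

theorem volume_real_pos (hX : IsCompact X) (hXi : (interior X).Nonempty) :
    0 < (volume : Measure (E d)).real X :=
  ENNReal.toReal_pos (Measure.measure_pos_of_nonempty_interior _ hXi).ne' hX.measure_lt_top.ne

/-- The height of the uniform density on `X`. -/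
noncomputable def unif (X : Set (E d)) : ℝ := ((volume : Measure (E d)).real X)⁻¹

theorem unif_pos (hX : IsCompact X) (hXi : (interior X).Nonempty) : 0 < unif X :=
  inv_pos.2 (volume_real_pos hX hXi)

/-- The uniform density belongs to every nonempty density class: its height is the mean value of any
other density. -/
theorem unif_mem (hX : IsCompact X) (hXi : (interior X).Nonempty) {L₀ : ℝ} (hL₀ : 0 ≤ L₀)
    {f : E d → ℝ}
    (hf : f ∈ densityClass X s L B' B) : (fun _ => unif X) ∈ densityClass X s L₀ B' B := by
  have hvol := volume_real_pos hX hXi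
  have hne : X.Nonempty := hXi.mono interior_subset
  refine ⟨⟨continuousOn_const, contDiffOn_const, ?_⟩, ?_, fun x _ => (unif_pos hX hXi).le, ?_⟩
  · intro k _ _ i x _ y _
    rw [partialDeriv_const i _ x y, sub_self, abs_zero]
    positivity
  · intro _ _
    obtain ⟨a, ha, hamin⟩ := hX.exists_isMinOn hne hf.1.1
    obtain ⟨b, hb, hbmax⟩ := hX.exists_isMaxOn hne hf.1.1
    have hint := hf.1.1.integrableOn_compact (μ := volume) hX
    refine (ordConnected_openInterval B' B).out (hf.2.1 a ha) (hf.2.1 b hb) ⟨?_, ?_⟩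
    · have : ∫ x in X, f a ≤ ∫ x in X, f x :=
        setIntegral_mono_on (continuousOn_const.integrableOn_compact hX) hint hX.measurableSet
          fun x hx => hamin hx
      rw [hf.2.2.2, setIntegral_const, smul_eq_mul] at this
      rw [unif, ← one_div, le_div_iff₀ hvol]
      linarith
    · have : ∫ x in X, f x ≤ ∫ x in X, f b :=
        setIntegral_mono_on hint (continuousOn_const.integrableOn_compact hX) hX.measurableSet
          fun x hx => hbmax hx
      rw [hf.2.2.2, setIntegral_const, smul_eq_mul] at this
      rw [unif, ← one_div, div_le_iff₀ hvol]
      linarith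
  · rw [setIntegral_const, smul_eq_mul, unif, mul_inv_cancel₀ hvol.ne']

/-- `Γ` is an admissible perturbation of size `η`: a function on the whole space of class `C^⌊s⌋`
with vanishing integral over `X`, bounded by `η`, and satisfying the Hölder conditions that define
`holderClass` everywhere, with constant `η`. -/
structure IsPerturbation (X : Set (E d)) (s η : ℝ) (Γ : E d → ℝ) : Prop where
  contDiff : ContDiff ℝ (⌊s⌋₊ : ℕ) Γ
  abs_le : ∀ x, |Γ x| ≤ η
  holder : ∀ k : ℕ, k ≤ ⌊s⌋₊ → s - k ≤ 1 → ∀ i : Fin k → Fin d, ∀ x y,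
    |partialDeriv k i Γ x - partialDeriv k i Γ y| ≤ η * ‖x - y‖ ^ (s - k)
  integral_eq : ∫ x in X, Γ x = 0

theorem IsPerturbation.mono {η η' : ℝ} {Γ : E d → ℝ} (h : IsPerturbation X s η Γ) (hη : η ≤ η') :
    IsPerturbation X s η' Γ :=
  ⟨h.contDiff, fun x => (h.abs_le x).trans hη,
    fun k hk hsk i x y => (h.holder k hk hsk i x y).trans (by gcongr), h.integral_eq⟩

theorem IsPerturbation.mem_holderClass {η : ℝ} {Γ : E d → ℝ} (h : IsPerturbation X s η Γ) :
    Γ ∈ holderClass X s η :=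
  ⟨h.contDiff.continuous.continuousOn, h.contDiff.contDiffOn,
    fun k hk hsk i x _ y _ => h.holder k hk hsk i x y⟩

theorem IsPerturbation.const_mul {η : ℝ} {Γ : E d → ℝ} (h : IsPerturbation X s η Γ) (a : ℝ) :
    IsPerturbation X s (|a| * η) (fun x => a * Γ x) := by
  refine ⟨contDiff_const.mul h.contDiff, fun x => ?_, fun k hk hsk i x y => ?_, ?_⟩
  · rw [abs_mul]
    exact mul_le_mul_of_nonneg_left (h.abs_le x) (abs_nonneg a)
  · have hk' : ∀ z, ContDiffAt ℝ k Γ z := fun z =>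
      (h.contDiff.of_le (by exact_mod_cast hk)).contDiffAt
    rw [partialDeriv_const_mul i a (hk' x), partialDeriv_const_mul i a (hk' y), ← mul_sub, abs_mul,
      mul_assoc]
    exact mul_le_mul_of_nonneg_left (h.holder k hk hsk i x y) (abs_nonneg a)
  · rw [integral_const_mul, h.integral_eq, mul_zero]

theorem IsPerturbation.add (hX : IsCompact X) {η₁ η₂ : ℝ} {Γ₁ Γ₂ : E d → ℝ}
    (h₁ : IsPerturbation X s η₁ Γ₁)
    (h₂ : IsPerturbation X s η₂ Γ₂) : IsPerturbation X s (η₁ + η₂) (fun x => Γ₁ x + Γ₂ x) := by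
  refine ⟨h₁.contDiff.add h₂.contDiff, fun x => (abs_add_le _ _).trans
    (add_le_add (h₁.abs_le x) (h₂.abs_le x)), fun k hk hsk i x y => ?_, ?_⟩
  · have hk₁ : ∀ z, ContDiffAt ℝ k Γ₁ z := fun z =>
      (h₁.contDiff.of_le (by exact_mod_cast hk)).contDiffAt
    have hk₂ : ∀ z, ContDiffAt ℝ k Γ₂ z := fun z =>
      (h₂.contDiff.of_le (by exact_mod_cast hk)).contDiffAt
    rw [partialDeriv_add i (hk₁ x) (hk₂ x), partialDeriv_add i (hk₁ y) (hk₂ y), add_sub_add_comm,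
      add_mul]
    exact (abs_add_le _ _).trans
      (add_le_add (h₁.holder k hk hsk i x y) (h₂.holder k hk hsk i x y))
  · rw [integral_add (h₁.contDiff.continuous.continuousOn.integrableOn_compact hX)
      (h₂.contDiff.continuous.continuousOn.integrableOn_compact hX), h₁.integral_eq,
      h₂.integral_eq, add_zero]

/-- `f` is a density of the class that is at least `η > 0` on `X` and stays in the class under all
perturbations of size `η`. -/
structure IsRoomy (X : Set (E d)) (s L : ℝ) (B' B : EReal) (η : ℝ) (f : E d → ℝ) : Prop where
  pos : 0 < η
  mem : f ∈ densityClass X s L B' B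
  le : ∀ x ∈ X, η ≤ f x
  add_mem : ∀ Γ, IsPerturbation X s η Γ → (fun x => f x + Γ x) ∈ densityClass X s L B' B

theorem IsRoomy.mono {η η' : ℝ} {f : E d → ℝ} (h : IsRoomy X s L B' B η f) (h0 : 0 < η')
    (hη : η' ≤ η) : IsRoomy X s L B' B η' f :=
  ⟨h0, h.mem, fun x hx => hη.trans (h.le x hx), fun Γ hΓ => h.add_mem Γ (hΓ.mono hη)⟩

theorem IsRoomy.add (hX : IsCompact X) {η : ℝ} {f Γ : E d → ℝ} (h : IsRoomy X s L B' B η f)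
    (hΓ : IsPerturbation X s (η / 2) Γ) : IsRoomy X s L B' B (η / 2) (fun x => f x + Γ x) := by
  have hη := h.pos
  refine ⟨half_pos hη, h.add_mem Γ (hΓ.mono (by linarith)), fun x hx => ?_, fun Γ' hΓ' => ?_⟩
  · have h1 := h.le x hx
    have h2 := (abs_le.1 (hΓ.abs_le x)).1
    linarith
  · have h1 := h.add_mem _ ((hΓ.add hX hΓ').mono (by linarith))
    simpa only [add_assoc] using h1

/-- Mixing a density with the uniform one creates room: it makes the density positive and lowers its
Hölder constant, while by compactness its values keep a positive distance from `B'` and `B`. -/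
theorem exists_isRoomy (hX : IsCompact X) (hXi : (interior X).Nonempty) (hL : 0 < L)
    {f : E d → ℝ} (hf : f ∈ densityClass X s L B' B) {ε : ℝ} (hε0 : 0 < ε) (hε1 : ε < 1) :
    ∃ η, IsRoomy X s L B' B η (fun x => (1 - ε) * f x + ε * unif X) := by
  have hne : X.Nonempty := hXi.mono interior_subset
  have hu := unif_pos hX hXi
  have hum := unif_mem (s := s) hX hXi hL.le hf
  set F : E d → ℝ := fun x => (1 - ε) * f x + ε * unif X with hF
  have hFm : F ∈ densityClass X s L B' B :=
    densityClass_combo hX (by linarith) hε0.le (by ring) hf hum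
  have hFh : F ∈ holderClass X s ((1 - ε) * L) :=
    holderClass_combo (by linarith) hε0.le hf.1 (unif_mem (s := s) hX hXi le_rfl hf).1
      (by simp)
  obtain ⟨a, ha, hamin⟩ := hX.exists_isMinOn hne hFm.1.1
  obtain ⟨b, hb, hbmax⟩ := hX.exists_isMaxOn hne hFm.1.1
  obtain ⟨r₁, hr₁, h₁⟩ := Metric.isOpen_iff.1 (isOpen_openInterval B' B) _ (hFm.2.1 a ha)
  obtain ⟨r₂, hr₂, h₂⟩ := Metric.isOpen_iff.1 (isOpen_openInterval B' B) _ (hFm.2.1 b hb)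
  have hεu : ∀ x ∈ X, ε * unif X ≤ F x := fun x hx => by
    have := hf.2.2.1 x hx
    have : 0 ≤ (1 - ε) * f x := mul_nonneg (by linarith) this
    simp only [hF]; linarith
  obtain ⟨η, hη0, hη⟩ : ∃ η, 0 < η ∧ η < r₁ ∧ η < r₂ ∧ η ≤ ε * unif X ∧ η ≤ ε * L := by
    refine ⟨min (min (r₁ / 2) (r₂ / 2)) (min (ε * unif X) (ε * L)), by positivity,
      ?_, ?_, ?_, ?_⟩
    · exact lt_of_le_of_lt ((min_le_left _ _).trans (min_le_left _ _)) (by linarith)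
    · exact lt_of_le_of_lt ((min_le_left _ _).trans (min_le_right _ _)) (by linarith)
    · exact (min_le_right _ _).trans (min_le_left _ _)
    · exact (min_le_right _ _).trans (min_le_right _ _)
  refine ⟨η, hη0, hFm, fun x hx => hη.2.2.1.trans (hεu x hx), fun Γ hΓ => ⟨?_, ?_, ?_, ?_⟩⟩
  · have := holderClass_combo (L := L) zero_le_one zero_le_one hFh hΓ.mem_holderClass
      (by have := hη.2.2.2; linarith)
    simpa only [one_mul] using this
  · intro x hx
    have hΓx := abs_le.1 (hΓ.abs_le x)
    have hax : F a ≤ F x := hamin hx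
    have hbx : F x ≤ F b := hbmax hx
    refine (ordConnected_openInterval B' B).out (h₁ (a := F a - η) ?_) (h₂ (a := F b + η) ?_)
      ⟨?_, ?_⟩
    · rw [Metric.mem_ball, Real.dist_eq, abs_lt]; constructor <;> linarith [hη.1]
    · rw [Metric.mem_ball, Real.dist_eq, abs_lt]; constructor <;> linarith [hη.2.1]
    · linarith
    · linarith
  · intro x hx
    have hΓx := abs_le.1 (hΓ.abs_le x)
    linarith [hεu x hx, hη.2.2.1]
  · rw [integral_add (hFm.1.1.integrableOn_compact hX)
      (hΓ.contDiff.continuous.continuousOn.integrableOn_compact hX), hFm.2.2.2, hΓ.integral_eq,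
      add_zero]

/-! ### Scaled bump functions -/

/-- A fixed smooth bump function, equal to one near the origin and supported in the unit ball. -/
noncomputable def bump (d : ℕ) : E d → ℝ :=
  (⟨1 / 2, 1, by norm_num, by norm_num⟩ : ContDiffBump (0 : E d))

theorem contDiff_bump {n : ℕ∞} : ContDiff ℝ n (bump d) := ContDiffBump.contDiff _

theorem hasCompactSupport_bump : HasCompactSupport (bump d) := ContDiffBump.hasCompactSupport _

theorem bump_nonneg (x : E d) : 0 ≤ bump d x := ContDiffBump.nonneg _

theorem bump_le_one (x : E d) : bump d x ≤ 1 := ContDiffBump.le_one _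

theorem bump_zero : bump d 0 = 1 := ContDiffBump.one_of_mem_closedBall _ (by simp)

theorem tsupport_bump : tsupport (bump d) = Metric.closedBall 0 1 := ContDiffBump.tsupport_eq _

theorem iteratedFDeriv_bump_eq_zero (k : ℕ) {x : E d} (hx : 1 < ‖x‖) :
    iteratedFDeriv ℝ k (bump d) x = 0 := by
  by_contra h
  have := support_iteratedFDeriv_subset (𝕜 := ℝ) (f := bump d) k (Function.mem_support.2 h)
  rw [tsupport_bump, mem_closedBall_zero_iff] at this
  linarith

theorem bump_eq_zero {x : E d} (hx : 1 < ‖x‖) : bump d x = 0 := by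
  by_contra h
  have := subset_tsupport _ (Function.mem_support.2 h)
  rw [tsupport_bump, mem_closedBall_zero_iff] at this
  linarith

/-- A `C^1` function of compact support is bounded and Lipschitz, hence Hölder continuous with
every exponent in `[0, 1]`, with a constant that does not depend on the exponent. -/
theorem exists_holder_of_hasCompactSupport {F : Type*} [NormedAddCommGroup F] [NormedSpace ℝ F]
    {G : E d → F} (hG : HasCompactSupport G) (hG1 : ContDiff ℝ 1 G) :
    ∃ C : ℝ, 0 ≤ C ∧ ∀ α : ℝ, 0 ≤ α → α ≤ 1 → ∀ x y, ‖G x - G y‖ ≤ C * ‖x - y‖ ^ α := by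
  obtain ⟨K, hK⟩ := hG1.lipschitzWith_of_hasCompactSupport hG one_ne_zero
  obtain ⟨M, hM⟩ := hG.exists_bound_of_continuous hG1.continuous
  have hM0 : 0 ≤ M := (norm_nonneg _).trans (hM 0)
  refine ⟨K + 2 * M, by positivity, fun α h0 h1 x y => ?_⟩
  rcases eq_or_ne x y with rfl | hxy
  · rw [sub_self, norm_zero]; positivity
  have hpos : 0 < ‖x - y‖ := norm_pos_iff.2 (sub_ne_zero.2 hxy)
  rcases le_total ‖x - y‖ 1 with h | h
  · calc ‖G x - G y‖ ≤ K * ‖x - y‖ := by simpa [dist_eq_norm] using hK.dist_le_mul x y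
      _ ≤ K * ‖x - y‖ ^ α := by
        gcongr
        simpa using Real.rpow_le_rpow_of_exponent_ge hpos h h1
      _ ≤ (K + 2 * M) * ‖x - y‖ ^ α := by gcongr; linarith
  · calc ‖G x - G y‖ ≤ 2 * M := (norm_sub_le _ _).trans (by linarith [hM x, hM y])
      _ ≤ (K + 2 * M) * 1 := by linarith [K.2, show (0:ℝ) ≤ K from K.2]
      _ ≤ (K + 2 * M) * ‖x - y‖ ^ α := by
        gcongr
        exact Real.one_le_rpow h h0

theorem abs_partialDeriv_sub_le {k : ℕ} (i : Fin k → Fin d) (f : E d → ℝ) (x y : E d) :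
    |partialDeriv k i f x - partialDeriv k i f y| ≤
      ‖iteratedFDeriv ℝ k f x - iteratedFDeriv ℝ k f y‖ := by
  unfold partialDeriv
  rw [← sub_apply, ← Real.norm_eq_abs]
  refine (ContinuousMultilinearMap.le_opNorm _ _).trans ?_
  simp

/-- One Hölder constant serves for all derivatives of the bump function that matter. -/
theorem exists_holder_bump (d : ℕ) (s : ℝ) (hs : 0 ≤ s) :
    ∃ C : ℝ, 0 ≤ C ∧ ∀ k : ℕ, k ≤ ⌊s⌋₊ → s - k ≤ 1 → ∀ i : Fin k → Fin d, ∀ x y,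
      |partialDeriv k i (bump d) x - partialDeriv k i (bump d) y| ≤ C * ‖x - y‖ ^ (s - k) := by
  have h : ∀ k : ℕ, ∃ C : ℝ, 0 ≤ C ∧ ∀ α : ℝ, 0 ≤ α → α ≤ 1 → ∀ x y,
      ‖iteratedFDeriv ℝ k (bump d) x - iteratedFDeriv ℝ k (bump d) y‖ ≤ C * ‖x - y‖ ^ α :=
    fun k => exists_holder_of_hasCompactSupport (hasCompactSupport_bump.iteratedFDeriv k)
      ((contDiff_bump (n := ⊤)).iteratedFDeriv_right (m := 1) (by exact_mod_cast le_top))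
  choose C hC0 hC using h
  refine ⟨∑ k ∈ Finset.range (⌊s⌋₊ + 1), C k, Finset.sum_nonneg fun k _ => hC0 k,
    fun k hk hsk i x y => ?_⟩
  have hk' : (k : ℝ) ≤ s := (Nat.le_floor_iff hs).1 hk
  refine (abs_partialDeriv_sub_le i _ x y).trans
    ((hC k (s - k) (by linarith) hsk x y).trans ?_)
  gcongr
  exact Finset.single_le_sum (f := C) (fun k _ => hC0 k) (Finset.mem_range.2 (by omega))

/-- The bump function moved to `p` and scaled to radius `r`. -/
noncomputable def bumpAt (p : E d) (r : ℝ) (x : E d) : ℝ := bump d (r⁻¹ • (x - p))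

theorem contDiff_bumpAt (p : E d) (r : ℝ) {n : ℕ∞} : ContDiff ℝ n (bumpAt p r) :=
  contDiff_bump.comp ((contDiff_id.sub contDiff_const).const_smul r⁻¹)

theorem bumpAt_self (p : E d) (r : ℝ) : bumpAt p r p = 1 := by
  rw [bumpAt, sub_self, smul_zero, bump_zero]

theorem norm_smul_sub_gt_one {p x : E d} {r : ℝ} (hr : 0 < r) (hx : r < dist x p) :
    1 < ‖r⁻¹ • (x - p)‖ := by
  rw [norm_smul, Real.norm_eq_abs, abs_of_pos (inv_pos.2 hr), ← dist_eq_norm, inv_mul_eq_div,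
    one_lt_div hr]
  exact hx

theorem bumpAt_eq_zero {p x : E d} {r : ℝ} (hr : 0 < r) (hx : r < dist x p) : bumpAt p r x = 0 :=
  bump_eq_zero (norm_smul_sub_gt_one hr hx)

theorem partialDeriv_bumpAt {k : ℕ} (i : Fin k → Fin d) (p : E d) (r : ℝ) (x : E d) :
    partialDeriv k i (bumpAt p r) x = (r⁻¹) ^ k * partialDeriv k i (bump d) (r⁻¹ • (x - p)) := by
  have e : bumpAt p r = fun z => (bump d ∘ (r⁻¹ • ContinuousLinearMap.id ℝ (E d))) (z - p) := by
    funext z; simp [bumpAt]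
  unfold partialDeriv
  rw [e, iteratedFDeriv_comp_sub,
    ContinuousLinearMap.iteratedFDeriv_comp_right _ (contDiff_bump (n := ⊤)) (i := k) _
      (by exact_mod_cast le_top)]
  simp only [ContinuousMultilinearMap.compContinuousLinearMap_apply, FunLike.coe_smul,
    Pi.smul_apply, ContinuousLinearMap.coe_id', id_eq]
  rw [ContinuousMultilinearMap.map_smul_univ]
  simp

theorem partialDeriv_bumpAt_eq_zero {k : ℕ} (i : Fin k → Fin d) {p x : E d} {r : ℝ} (hr : 0 < r)
    (hx : r < dist x p) : partialDeriv k i (bumpAt p r) x = 0 := by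
  rw [partialDeriv_bumpAt, partialDeriv, iteratedFDeriv_bump_eq_zero k
    (norm_smul_sub_gt_one hr hx)]
  simp

/-- At most one ball of a separated family contains a given point. -/
theorem sum_ite_dist_le {ι : Type*} [Fintype ι] {p : ι → E d} {r H : ℝ} (hH : 0 ≤ H)
    (hp : ∀ i j, i ≠ j → 2 * r < dist (p i) (p j)) (x : E d) :
    ∑ i, (if dist x (p i) ≤ r then H else 0) ≤ H := by
  classical
  rw [← Finset.sum_filter, Finset.sum_const, nsmul_eq_mul]
  have hc : (Finset.univ.filter fun i => dist x (p i) ≤ r).card ≤ 1 := by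
    rw [Finset.card_le_one]
    intro i hi j hj
    by_contra hij
    have h1 := (Finset.mem_filter.1 hi).2
    have h2 := (Finset.mem_filter.1 hj).2
    have := dist_triangle_left (p i) (p j) x
    linarith [hp i j hij]
  calc ((Finset.univ.filter fun i => dist x (p i) ≤ r).card : ℝ) * H ≤ 1 * H := by
        gcongr; exact_mod_cast hc
    _ = H := one_mul H

/-- A combination of separated bumps of radius `r`, with coefficients in `[-1, 1]`, is Hölder of
order `s` once multiplied by `r ^ s`, uniformly in the number of bumps. -/
theorem exists_isPerturbation_bumps (d : ℕ) (s : ℝ) (hs : 0 < s) :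
    ∃ ε₀ : ℝ, 0 < ε₀ ∧ ∀ (X : Set (E d)) (ι : Type) [Fintype ι] (p : ι → E d) (c : ι → ℝ)
      (r η : ℝ), 0 < r → r ≤ 1 → 0 ≤ η → (∀ i j, i ≠ j → 2 * r < dist (p i) (p j)) →
      (∀ i, |c i| ≤ 1) → ∫ x in X, ∑ i, c i * bumpAt (p i) r x = 0 →
      IsPerturbation X s η fun x => ε₀ * η * r ^ s * ∑ i, c i * bumpAt (p i) r x := by
  obtain ⟨C, hC0, hC⟩ := exists_holder_bump d s hs.le
  refine ⟨(2 * C + 1)⁻¹, by positivity, ?_⟩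
  intro X ι _ p c r η hr hr1 hη hp hc hint
  set ε := (2 * C + 1)⁻¹ with hε
  have hε1 : ε ≤ 1 := inv_le_one_of_one_le₀ (by linarith)
  have hε2 : ε * (2 * C) ≤ 1 := by
    rw [hε, inv_mul_eq_div, div_le_one (by positivity)]; linarith
  have hε0 : 0 < ε := by positivity
  have hrs : r ^ s ≤ 1 := Real.rpow_le_one hr.le hr1 hs.le
  have hrs0 : 0 < r ^ s := by positivity
  have hcd : ∀ i : ι, ∀ k : ℕ, ContDiff ℝ k (fun x => c i * bumpAt (p i) r x) := fun i k =>
    contDiff_const.mul (contDiff_bumpAt _ _)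
  refine ⟨contDiff_const.mul (ContDiff.sum fun i _ => hcd i _), fun x => ?_, ?_, ?_⟩
  · have h1 : |∑ i, c i * bumpAt (p i) r x| ≤ 1 := by
      refine (Finset.abs_sum_le_sum_abs _ _).trans ?_
      refine (Finset.sum_le_sum fun i _ => ?_).trans (sum_ite_dist_le zero_le_one hp x)
      split_ifs with h
      · rw [abs_mul]
        have h1 : |bumpAt (p i) r x| ≤ 1 := by
          rw [bumpAt, abs_of_nonneg (bump_nonneg _)]; exact bump_le_one _
        calc |c i| * |bumpAt (p i) r x| ≤ 1 * 1 := mul_le_mul (hc i) h1 (abs_nonneg _) zero_le_one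
          _ = 1 := one_mul 1
      · rw [bumpAt_eq_zero hr (not_le.1 h), mul_zero, abs_zero]
    rw [abs_mul, abs_of_nonneg (by positivity)]
    calc ε * η * r ^ s * |∑ i, c i * bumpAt (p i) r x| ≤ 1 * η * 1 * 1 := by gcongr
      _ = η := by ring
  · intro k hk hsk j x y
    have hks : (k : ℝ) ≤ s := (Nat.le_floor_iff hs.le).1 hk
    have e : ∀ z, partialDeriv k j (fun x => ε * η * r ^ s * ∑ i, c i * bumpAt (p i) r x) z =
        ε * η * r ^ s * ∑ i, c i * partialDeriv k j (bumpAt (p i) r) z := by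
      intro z
      rw [partialDeriv_const_mul j _ (ContDiff.sum fun i _ => hcd i _).contDiffAt]
      congr 1
      have h1 : partialDeriv k j (fun x => ∑ i, c i * bumpAt (p i) r x) z =
          ∑ i, partialDeriv k j (fun x => c i * bumpAt (p i) r x) z := by
        unfold partialDeriv
        rw [iteratedFDeriv_fun_sum_apply fun i _ => (hcd i k).contDiffAt]
        rw [sum_apply]
      rw [h1]
      exact Finset.sum_congr rfl fun i _ =>
        partialDeriv_const_mul j _ (contDiff_bumpAt _ _ (n := k)).contDiffAt
    set H : ℝ := C * (r ^ s)⁻¹ * ‖x - y‖ ^ (s - k) with hH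
    have hH0 : 0 ≤ H := by positivity
    have hone : ∀ i, |partialDeriv k j (bumpAt (p i) r) x - partialDeriv k j (bumpAt (p i) r) y|
        ≤ H := by
      intro i
      rw [partialDeriv_bumpAt, partialDeriv_bumpAt, ← mul_sub, abs_mul,
        abs_of_pos (by positivity)]
      refine (mul_le_mul_of_nonneg_left (hC k hk hsk j _ _) (by positivity)).trans (le_of_eq ?_)
      rw [← smul_sub, sub_sub_sub_cancel_right, norm_smul, Real.norm_eq_abs,
        abs_of_pos (inv_pos.2 hr), Real.mul_rpow (by positivity) (norm_nonneg _), hH,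
        Real.inv_rpow hr.le, Real.rpow_sub hr, Real.rpow_natCast, inv_pow]
      field_simp
    -- `x` and `y` lie in at most one ball each, and only the bumps of these balls contribute.
    have hsum : |∑ i, c i * partialDeriv k j (bumpAt (p i) r) x -
        ∑ i, c i * partialDeriv k j (bumpAt (p i) r) y| ≤ 2 * H := by
      rw [← Finset.sum_sub_distrib]
      refine (Finset.abs_sum_le_sum_abs _ _).trans ?_
      calc ∑ i, |c i * partialDeriv k j (bumpAt (p i) r) x -
            c i * partialDeriv k j (bumpAt (p i) r) y|
          ≤ ∑ i, ((if dist x (p i) ≤ r then H else 0) + if dist y (p i) ≤ r then H else 0) := by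
            refine Finset.sum_le_sum fun i _ => ?_
            rw [← mul_sub, abs_mul]
            have h1 : |c i| * |partialDeriv k j (bumpAt (p i) r) x -
                partialDeriv k j (bumpAt (p i) r) y| ≤ 1 * H :=
              mul_le_mul (hc i) (hone i) (abs_nonneg _) zero_le_one
            by_cases hx : dist x (p i) ≤ r
            · rw [if_pos hx]
              split_ifs <;> linarith
            · by_cases hy : dist y (p i) ≤ r
              · rw [if_pos hy, if_neg hx]; linarith
              · rw [if_neg hx, if_neg hy, partialDeriv_bumpAt_eq_zero j hr (not_le.1 hx),
                  partialDeriv_bumpAt_eq_zero j hr (not_le.1 hy)]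
                simp
        _ ≤ H + H := by
            rw [Finset.sum_add_distrib]
            exact add_le_add (sum_ite_dist_le hH0 hp x) (sum_ite_dist_le hH0 hp y)
        _ = 2 * H := by ring
    rw [e x, e y, ← mul_sub, abs_mul, abs_of_nonneg (by positivity)]
    calc ε * η * r ^ s * |∑ i, c i * partialDeriv k j (bumpAt (p i) r) x -
          ∑ i, c i * partialDeriv k j (bumpAt (p i) r) y| ≤ ε * η * r ^ s * (2 * H) := by gcongr
      _ = (ε * (2 * C)) * (η * ‖x - y‖ ^ (s - k)) := by rw [hH]; field_simp
      _ ≤ 1 * (η * ‖x - y‖ ^ (s - k)) := by gcongr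
      _ = η * ‖x - y‖ ^ (s - k) := one_mul _
  · rw [integral_const_mul, hint, mul_zero]

/-- The integral of a function of a bump depends on its centre not at all and on its radius through
the volume factor only, as long as the bump is supported in `X`. -/
theorem setIntegral_comp_bumpAt {p : E d} {r : ℝ} (hr : 0 < r) (hX : Metric.closedBall p r ⊆ X)
    (F : ℝ → ℝ) (hF : F 0 = 0) :
    ∫ x in X, F (bumpAt p r x) = r ^ d * ∫ x, F (bump d x) := by
  rw [setIntegral_eq_integral_of_forall_compl_eq_zero]
  · have h1 := Measure.integral_comp_smul (volume : Measure (E d)) (fun x => F (bump d x)) r⁻¹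
    have h2 := integral_sub_right_eq_self (μ := (volume : Measure (E d)))
      (fun x => F (bump d (r⁻¹ • x))) p
    simp only [bumpAt]
    rw [h2, h1, finrank_euclideanSpace_fin, inv_pow, inv_inv, abs_of_pos (by positivity),
      smul_eq_mul]
  · intro x hx
    rw [bumpAt_eq_zero hr, hF]
    by_contra h
    exact hx (hX (not_lt.1 h))

theorem bumpAt_mul_bumpAt_eq_zero {p q : E d} {r : ℝ} (hr : 0 < r) (hpq : 2 * r < dist p q)
    (x : E d) : bumpAt p r x * bumpAt q r x = 0 := by
  by_cases h : r < dist x p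
  · rw [bumpAt_eq_zero hr h, zero_mul]
  · rw [bumpAt_eq_zero (p := q) hr, mul_zero]
    have := dist_triangle_left p q x
    linarith

theorem integral_bump_sq_pos : 0 < ∫ x, bump d x ^ 2 := by
  have hc : Continuous (bump d) := (contDiff_bump (n := 0)).continuous
  refine (hc.pow 2).integral_pos_of_hasCompactSupport_nonneg_nonzero (x := 0) ?_
    (fun x => sq_nonneg _) (by rw [bump_zero]; norm_num)
  exact hasCompactSupport_bump.comp_left (g := fun t : ℝ => t ^ 2) (by norm_num)

/-! ### Derivative of the functional along segments -/

/-- The functional `(f, g) ↦ ∫ ν(f, g)` is continuous in the uniform norm. -/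
theorem exists_abs_integral_sub_le (hX : IsCompact X) {I : Set ℝ} (hI : IsOpen I) {ν : ℝ × ℝ → ℝ}
    (hν : ContinuousOn ν (I ×ˢ I)) {f g : E d → ℝ} (hf : ContinuousOn f X) (hg : ContinuousOn g X)
    (hfI : ∀ x ∈ X, f x ∈ I) (hgI : ∀ x ∈ X, g x ∈ I) {ε : ℝ} (hε : 0 < ε) :
    ∃ δ > 0, ∀ f' g' : E d → ℝ, ContinuousOn f' X → ContinuousOn g' X →
      (∀ x ∈ X, f' x ∈ I) → (∀ x ∈ X, g' x ∈ I) → (∀ x ∈ X, |f' x - f x| < δ) →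
      (∀ x ∈ X, |g' x - g x| < δ) →
      |(∫ x in X, ν (f' x, g' x)) - ∫ x in X, ν (f x, g x)| < ε := by
  set V := (volume : Measure (E d)).real X with hV
  have hV0 : 0 ≤ V := measureReal_nonneg
  set K := (fun x => (f x, g x)) '' X with hK
  have hKc : IsCompact K := hX.image_of_continuousOn (hf.prodMk hg)
  have hcont : ∀ z ∈ K, ContinuousAt ν z := by
    rintro _ ⟨x, hx, rfl⟩
    exact hν.continuousAt ((hI.prod hI).mem_nhds ⟨hfI x hx, hgI x hx⟩)
  have hε' : 0 < ε / (V + 1) := by positivity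
  obtain ⟨δ, hδ, h⟩ := Metric.mem_uniformity_dist.1
    (hKc.uniformContinuousAt_of_continuousAt ν hcont (Metric.dist_mem_uniformity hε'))
  refine ⟨δ, hδ, fun f' g' hf' hg' hf'I hg'I hff hgg => ?_⟩
  have hi : ∀ {f g : E d → ℝ}, ContinuousOn f X → ContinuousOn g X → (∀ x ∈ X, f x ∈ I) →
      (∀ x ∈ X, g x ∈ I) → IntegrableOn (fun x => ν (f x, g x)) X := fun hf hg hfI hgI =>
    (hν.comp (hf.prodMk hg) fun x hx => ⟨hfI x hx, hgI x hx⟩).integrableOn_compact hX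
  rw [← integral_sub (hi hf' hg' hf'I hg'I) (hi hf hg hfI hgI), ← Real.norm_eq_abs]
  refine lt_of_le_of_lt (norm_setIntegral_le_of_norm_le_const (C := ε / (V + 1))
    hX.measure_lt_top fun x hx => ?_) ?_
  · have h1 := h (a := (f x, g x)) (b := (f' x, g' x)) (by
      rw [Prod.dist_eq, Real.dist_eq, Real.dist_eq, max_lt_iff]
      exact ⟨by rw [abs_sub_comm]; exact hff x hx, by rw [abs_sub_comm]; exact hgg x hx⟩)
      ⟨x, hx, rfl⟩
    have h2 : dist (ν (f x, g x)) (ν (f' x, g' x)) < ε / (V + 1) := h1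
    rw [dist_comm, Real.dist_eq] at h2
    exact h2.le
  · rw [← hV, div_mul_eq_mul_div, div_lt_iff₀ (by positivity)]
    nlinarith

/-- Differentiation of `∫ ν(f, g)` along a line. -/
theorem hasDerivAt_integral_line (hX : IsCompact X) {I : Set ℝ} (hI : IsOpen I) {ν : ℝ × ℝ → ℝ}
    (hν : ContDiffOn ℝ 2 ν (I ×ˢ I)) {f g u v : E d → ℝ} (hf : ContinuousOn f X)
    (hg : ContinuousOn g X) (hu : ContinuousOn u X) (hv : ContinuousOn v X) {τ : ℝ} (hτ : 0 < τ)
    (hmem : ∀ t : ℝ, |t| ≤ τ → ∀ x ∈ X, f x + t * u x ∈ I ∧ g x + t * v x ∈ I) :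
    HasDerivAt (fun t : ℝ => ∫ x in X, ν (f x + t * u x, g x + t * v x))
      (∫ x in X, fderiv ℝ ν (f x, g x) (u x, v x)) 0 := by
  have hO : IsOpen (I ×ˢ I) := hI.prod hI
  have hfd : ContinuousOn (fderiv ℝ ν) (I ×ˢ I) :=
    hν.continuousOn_fderiv_of_isOpen hO (by norm_num)
  set D : ℝ → E d → ℝ := fun t x => fderiv ℝ ν (f x + t * u x, g x + t * v x) (u x, v x) with hD
  have hpath : ContinuousOn (fun q : ℝ × E d => (f q.2 + q.1 * u q.2, g q.2 + q.1 * v q.2))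
      (Set.Icc (-τ) τ ×ˢ X) := by
    have h2 : Set.MapsTo (Prod.snd : ℝ × E d → E d) (Set.Icc (-τ) τ ×ˢ X) X := fun q hq => hq.2
    exact ((hf.comp continuousOn_snd h2).add
      (continuousOn_fst.mul (hu.comp continuousOn_snd h2))).prodMk
      ((hg.comp continuousOn_snd h2).add (continuousOn_fst.mul (hv.comp continuousOn_snd h2)))
  have hmaps : Set.MapsTo (fun q : ℝ × E d => (f q.2 + q.1 * u q.2, g q.2 + q.1 * v q.2))
      (Set.Icc (-τ) τ ×ˢ X) (I ×ˢ I) := fun q hq => hmem q.1 (abs_le.2 hq.1) q.2 hq.2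
  have hDc : ContinuousOn (fun q : ℝ × E d => D q.1 q.2) (Set.Icc (-τ) τ ×ˢ X) := by
    have h2 : Set.MapsTo (Prod.snd : ℝ × E d → E d) (Set.Icc (-τ) τ ×ˢ X) X := fun q hq => hq.2
    exact (hfd.comp hpath hmaps).clm_apply
      ((hu.comp continuousOn_snd h2).prodMk (hv.comp continuousOn_snd h2))
  obtain ⟨M, hM⟩ := (isCompact_Icc.prod hX).exists_bound_of_continuousOn hDc
  have hslice : ∀ t ∈ Set.Icc (-τ) τ,
      ContinuousOn (fun x => ν (f x + t * u x, g x + t * v x)) X := fun t ht =>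
    hν.continuousOn.comp ((hf.add (continuousOn_const.mul hu)).prodMk
      (hg.add (continuousOn_const.mul hv))) fun x hx => hmem t (abs_le.2 ht) x hx
  have h0 : (0 : ℝ) ∈ Set.Icc (-τ) τ := ⟨by linarith, hτ.le⟩
  have hnh : Set.Icc (-τ) τ ∈ 𝓝 (0 : ℝ) := Icc_mem_nhds (by linarith) hτ
  have hD0 : ContinuousOn (D 0) X :=
    hDc.comp (continuousOn_const.prodMk continuousOn_id) fun x hx => ⟨h0, hx⟩
  have key := hasDerivAt_integral_of_dominated_loc_of_deriv_le (μ := volume.restrict X)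
    (F := fun t x => ν (f x + t * u x, g x + t * v x)) (F' := D) (x₀ := (0 : ℝ))
    (s := Set.Icc (-τ) τ) (bound := fun _ => M) hnh
    (by
      filter_upwards [hnh] with t ht
      exact (hslice t ht).aestronglyMeasurable hX.measurableSet)
    ((hslice 0 h0).integrableOn_compact hX) (hD0.aestronglyMeasurable hX.measurableSet)
    ((ae_restrict_iff' hX.measurableSet).2 (ae_of_all _ fun x hx t ht => hM (t, x) ⟨ht, hx⟩))
    (continuousOn_const.integrableOn_compact hX)
    ((ae_restrict_iff' hX.measurableSet).2 (ae_of_all _ fun x hx t ht => by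
      have h1 : HasDerivAt (fun t : ℝ => (f x + t * u x, g x + t * v x)) (u x, v x) t := by
        have a1 := ((hasDerivAt_id t).mul_const (u x)).const_add (f x)
        have a2 := ((hasDerivAt_id t).mul_const (v x)).const_add (g x)
        simpa using a1.prodMk a2
      have h2 : HasFDerivAt ν (fderiv ℝ ν (f x + t * u x, g x + t * v x))
          (f x + t * u x, g x + t * v x) :=
        ((hν.contDiffAt (hO.mem_nhds (hmem t (abs_le.2 ht) x hx))).differentiableAt
          (by norm_num)).hasFDerivAt
      exact h2.comp_hasDerivAt t h1))
  have := key.2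
  simpa [hD] using this

/-- The functional `(f, g) ↦ ∫ ν(f, g)` is continuous along the segment between two pairs. -/
theorem continuousOn_integral_segment (hX : IsCompact X) {I : Set ℝ} (hI : IsOpen I)
    (hIc : Convex ℝ I) {ν : ℝ × ℝ → ℝ} (hν : ContinuousOn ν (I ×ˢ I)) {f₀ g₀ f₁ g₁ : E d → ℝ}
    (hf₀ : ContinuousOn f₀ X) (hg₀ : ContinuousOn g₀ X)
    (hf₁ : ContinuousOn f₁ X) (hg₁ : ContinuousOn g₁ X)
    (hf₀I : ∀ x ∈ X, f₀ x ∈ I) (hg₀I : ∀ x ∈ X, g₀ x ∈ I)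
    (hf₁I : ∀ x ∈ X, f₁ x ∈ I) (hg₁I : ∀ x ∈ X, g₁ x ∈ I) :
    ContinuousOn (fun t : ℝ => ∫ x in X, ν ((1 - t) * f₀ x + t * f₁ x, (1 - t) * g₀ x + t * g₁ x))
      (Set.Icc 0 1) := by
  intro t ht
  have hc : ∀ {f₀ f₁ : E d → ℝ}, ContinuousOn f₀ X → ContinuousOn f₁ X → ∀ t : ℝ,
      ContinuousOn (fun x => (1 - t) * f₀ x + t * f₁ x) X := fun h h' t =>
    (continuousOn_const.mul h).add (continuousOn_const.mul h')
  have hm : ∀ {f₀ f₁ : E d → ℝ}, (∀ x ∈ X, f₀ x ∈ I) → (∀ x ∈ X, f₁ x ∈ I) →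
      ∀ t ∈ Set.Icc (0:ℝ) 1, ∀ x ∈ X, (1 - t) * f₀ x + t * f₁ x ∈ I := fun h h' t ht x hx =>
    hIc (h x hx) (h' x hx) (by linarith [ht.2]) ht.1 (by ring)
  obtain ⟨M₁, hM₁⟩ := hX.exists_bound_of_continuousOn (hf₁.sub hf₀)
  obtain ⟨M₂, hM₂⟩ := hX.exists_bound_of_continuousOn (hg₁.sub hg₀)
  set M := |M₁| + |M₂| + 1 with hM
  have hM0 : 0 < M := by positivity
  rw [Metric.continuousWithinAt_iff]
  intro ε hε
  obtain ⟨δ, hδ, h⟩ := exists_abs_integral_sub_le hX hI hν (hc hf₀ hf₁ t) (hc hg₀ hg₁ t)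
    (hm hf₀I hf₁I t ht) (hm hg₀I hg₁I t ht) hε
  refine ⟨δ / M, by positivity, fun {t'} ht' hd => ?_⟩
  rw [Real.dist_eq, lt_div_iff₀ hM0] at hd
  rw [Real.dist_eq]
  refine h _ _ (hc hf₀ hf₁ t') (hc hg₀ hg₁ t') (hm hf₀I hf₁I t' ht') (hm hg₀I hg₁I t' ht') ?_ ?_
  · intro x hx
    have h1 : |f₁ x - f₀ x| ≤ M := by
      have : ‖f₁ x - f₀ x‖ ≤ M₁ := hM₁ x hx
      rw [Real.norm_eq_abs] at this
      linarith [le_abs_self M₁, abs_nonneg M₂]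
    calc |(1 - t') * f₀ x + t' * f₁ x - ((1 - t) * f₀ x + t * f₁ x)|
        = |t' - t| * |f₁ x - f₀ x| := by rw [← abs_mul]; ring_nf
      _ ≤ |t' - t| * M := by gcongr
      _ < δ := hd
  · intro x hx
    have h1 : |g₁ x - g₀ x| ≤ M := by
      have : ‖g₁ x - g₀ x‖ ≤ M₂ := hM₂ x hx
      rw [Real.norm_eq_abs] at this
      linarith [le_abs_self M₂, abs_nonneg M₁]
    calc |(1 - t') * g₀ x + t' * g₁ x - ((1 - t) * g₀ x + t * g₁ x)|
        = |t' - t| * |g₁ x - g₀ x| := by rw [← abs_mul]; ring_nf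
      _ ≤ |t' - t| * M := by gcongr
      _ < δ := hd

theorem hasDerivAt_of_contDiffOn {φ : ℝ → ℝ} {U : Set ℝ} (hU : IsOpen U) (hφ : ContDiffOn ℝ 2 φ U)
    {y : ℝ} (hy : y ∈ U) : HasDerivAt φ (deriv φ y) y :=
  ((hφ.contDiffAt (hU.mem_nhds hy)).differentiableAt (by norm_num)).hasDerivAt

/-- If the functional is not constant, there is a pair of roomy densities at which it has a
nonzero derivative in some direction along which the pair can be moved inside the class. The pair
is found by the mean value theorem, on a segment between two pairs with different values. -/
theorem exists_isRoomy_derivative_ne_zero (hX : IsCompact X) (hXi : (interior X).Nonempty)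
    (hL : 0 < L) {ν : ℝ × ℝ → ℝ}
    (hν : ContDiffOn ℝ 2 ν (openInterval B' B ×ˢ openInterval B' B))
    {φ : ℝ → ℝ} {U : Set ℝ} (hU : IsOpen U) (hφ : ContDiffOn ℝ 2 φ U)
    (hνU : ∀ f ∈ densityClass X s L B' B, ∀ g ∈ densityClass X s L B' B,
      (∫ x in X, ν (f x, g x)) ∈ U)
    (hT : ∃ f₀ ∈ densityClass X s L B' B, ∃ g₀ ∈ densityClass X s L B' B,
      ∃ f₁ ∈ densityClass X s L B' B, ∃ g₁ ∈ densityClass X s L B' B,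
        functional X φ ν f₀ g₀ ≠ functional X φ ν f₁ g₁) :
    ∃ (f g u v : E d → ℝ) (η τ : ℝ), IsRoomy X s L B' B η f ∧ IsRoomy X s L B' B η g ∧
      ContinuousOn u X ∧ ContinuousOn v X ∧ ∫ x in X, u x = 0 ∧ ∫ x in X, v x = 0 ∧ 0 < τ ∧
      (∀ t : ℝ, |t| ≤ τ → (fun x => f x + t * u x) ∈ densityClass X s L B' B ∧
        (fun x => g x + t * v x) ∈ densityClass X s L B' B) ∧
      deriv φ (∫ x in X, ν (f x, g x)) ≠ 0 ∧
      ∫ x in X, fderiv ℝ ν (f x, g x) (u x, v x) ≠ 0 := by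
  obtain ⟨f₀, hf₀, g₀, hg₀, f₁, hf₁, g₁, hg₁, hne⟩ := hT
  set I := openInterval B' B with hI
  have hIo : IsOpen I := isOpen_openInterval B' B
  have hIc : Convex ℝ I := (ordConnected_openInterval B' B).convex
  have hum := unif_mem (s := s) hX hXi hL.le hf₀
  have hseg : ∀ {f₀ g₀ f₁ g₁ : E d → ℝ}, f₀ ∈ densityClass X s L B' B →
      g₀ ∈ densityClass X s L B' B → f₁ ∈ densityClass X s L B' B →
      g₁ ∈ densityClass X s L B' B →
      ContinuousOn (fun t : ℝ => functional X φ ν (fun x => (1 - t) * f₀ x + t * f₁ x)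
        (fun x => (1 - t) * g₀ x + t * g₁ x)) (Set.Icc 0 1) := by
    intro f₀ g₀ f₁ g₁ hf₀ hg₀ hf₁ hg₁
    refine hφ.continuousOn.comp (continuousOn_integral_segment hX hIo hIc hν.continuousOn hf₀.1.1
      hg₀.1.1 hf₁.1.1 hg₁.1.1 hf₀.2.1 hg₀.2.1 hf₁.2.1 hg₁.2.1) fun t ht => ?_
    exact hνU _ (densityClass_combo hX (by linarith [ht.2]) ht.1 (by ring) hf₀ hf₁) _
      (densityClass_combo hX (by linarith [ht.2]) ht.1 (by ring) hg₀ hg₁)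
  -- Mixing both pairs with the uniform density keeps the two values distinct.
  obtain ⟨ε, ⟨hε0, hε1⟩, hneε⟩ : ∃ ε ∈ Set.Ioo (0 : ℝ) 1,
      functional X φ ν (fun x => (1 - ε) * f₀ x + ε * unif X)
        (fun x => (1 - ε) * g₀ x + ε * unif X) ≠
      functional X φ ν (fun x => (1 - ε) * f₁ x + ε * unif X)
        (fun x => (1 - ε) * g₁ x + ε * unif X) := by
    have h0 : (0 : ℝ) ∈ Set.Icc (0 : ℝ) 1 := ⟨le_rfl, zero_le_one⟩
    have c1 := (hseg hf₀ hg₀ hum hum) 0 h0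
    have c2 := (hseg hf₁ hg₁ hum hum) 0 h0
    have c3 := (c1.sub c2).tendsto.eventually_ne (b₂ := 0) (by simpa using sub_ne_zero.2 hne)
    have c4 : ∀ᶠ ε in 𝓝[>] (0 : ℝ), ε ∈ Set.Ioo (0 : ℝ) 1 := Ioo_mem_nhdsGT one_pos
    have c5 : 𝓝[>] (0 : ℝ) ≤ 𝓝[Set.Icc 0 1] 0 := by
      rw [nhdsWithin_le_iff]
      filter_upwards [c4] with ε hε using ⟨hε.1.le, hε.2.le⟩
    obtain ⟨ε, hε, hε'⟩ := (c4.and (c5 c3)).exists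
    exact ⟨ε, hε, sub_ne_zero.1 hε'⟩
  set F₀ : E d → ℝ := fun x => (1 - ε) * f₀ x + ε * unif X with hF₀
  set G₀ : E d → ℝ := fun x => (1 - ε) * g₀ x + ε * unif X with hG₀
  set F₁ : E d → ℝ := fun x => (1 - ε) * f₁ x + ε * unif X with hF₁
  set G₁ : E d → ℝ := fun x => (1 - ε) * g₁ x + ε * unif X with hG₁
  have mix : ∀ {f : E d → ℝ}, f ∈ densityClass X s L B' B →
      (fun x => (1 - ε) * f x + ε * unif X) ∈ densityClass X s L B' B := fun h =>
    densityClass_combo hX (by linarith) hε0.le (by ring) h hum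
  have mF₀ : F₀ ∈ densityClass X s L B' B := mix hf₀
  have mG₀ : G₀ ∈ densityClass X s L B' B := mix hg₀
  have mF₁ : F₁ ∈ densityClass X s L B' B := mix hf₁
  have mG₁ : G₁ ∈ densityClass X s L B' B := mix hg₁
  set N : ℝ → ℝ := fun t => ∫ x in X, ν ((1 - t) * F₀ x + t * F₁ x, (1 - t) * G₀ x + t * G₁ x)
    with hN
  set u : E d → ℝ := fun x => F₁ x - F₀ x with hu
  set v : E d → ℝ := fun x => G₁ x - G₀ x with hv
  have huc : ContinuousOn u X := mF₁.1.1.sub mF₀.1.1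
  have hvc : ContinuousOn v X := mG₁.1.1.sub mG₀.1.1
  have hmemt : ∀ t ∈ Set.Icc (0 : ℝ) 1,
      (fun x => (1 - t) * F₀ x + t * F₁ x) ∈ densityClass X s L B' B ∧
      (fun x => (1 - t) * G₀ x + t * G₁ x) ∈ densityClass X s L B' B := fun t ht =>
    ⟨densityClass_combo hX (by linarith [ht.2]) ht.1 (by ring) mF₀ mF₁,
      densityClass_combo hX (by linarith [ht.2]) ht.1 (by ring) mG₀ mG₁⟩
  -- Around an interior time the segment can be followed in both directions.
  have hline : ∀ t ∈ Set.Ioo (0 : ℝ) 1, ∀ h : ℝ, |h| ≤ min t (1 - t) →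
      (fun x => ((1 - t) * F₀ x + t * F₁ x) + h * u x) ∈ densityClass X s L B' B ∧
      (fun x => ((1 - t) * G₀ x + t * G₁ x) + h * v x) ∈ densityClass X s L B' B := by
    intro t ht h hh
    have h1 := abs_le.1 (hh.trans (min_le_left _ _))
    have h2 := abs_le.1 (hh.trans (min_le_right _ _))
    have h3 := hmemt (t + h) ⟨by linarith, by linarith⟩
    have e : ∀ a b : ℝ, (1 - t) * a + t * b + h * (b - a) = (1 - (t + h)) * a + (t + h) * b := by
      intro a b; ring
    simpa only [hu, hv, e] using h3
  have hderiv : ∀ t ∈ Set.Ioo (0 : ℝ) 1, HasDerivAt N (∫ x in X,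
      fderiv ℝ ν ((1 - t) * F₀ x + t * F₁ x, (1 - t) * G₀ x + t * G₁ x) (u x, v x)) t := by
    intro t ht
    have htau : 0 < min t (1 - t) := lt_min ht.1 (by linarith [ht.2])
    have h1 := hasDerivAt_integral_line hX hIo hν
      (hmemt t ⟨ht.1.le, ht.2.le⟩).1.1.1 (hmemt t ⟨ht.1.le, ht.2.le⟩).2.1.1 huc hvc htau
      (fun h hh x hx => ⟨(hline t ht h hh).1.2.1 x hx, (hline t ht h hh).2.2.1 x hx⟩)
    have h2 : HasDerivAt (fun r : ℝ => ∫ x in X, ν ((1 - t) * F₀ x + t * F₁ x + (r - t) * u x,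
        (1 - t) * G₀ x + t * G₁ x + (r - t) * v x)) _ t :=
      HasDerivAt.comp_sub_const t t (by rwa [sub_self])
    convert h2 using 1
    funext r
    simp only [hN, hu, hv]
    congr 1
    funext x
    congr 2 <;> ring
  have hUt : ∀ t ∈ Set.Icc (0 : ℝ) 1, N t ∈ U := fun t ht =>
    hνU _ (hmemt t ht).1 _ (hmemt t ht).2
  have hcont : ContinuousOn (fun t => φ (N t)) (Set.Icc 0 1) := hseg mF₀ mG₀ mF₁ mG₁
  obtain ⟨t, ht, hteq⟩ := exists_hasDerivAt_eq_slope (fun t => φ (N t))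
    (fun t => deriv φ (N t) * ∫ x in X,
      fderiv ℝ ν ((1 - t) * F₀ x + t * F₁ x, (1 - t) * G₀ x + t * G₁ x) (u x, v x))
    one_pos hcont (fun t ht => (hasDerivAt_of_contDiffOn hU hφ
      (hUt t ⟨ht.1.le, ht.2.le⟩)).comp t (hderiv t ht))
  have hne' : φ (N 1) - φ (N 0) ≠ 0 := by
    rw [sub_ne_zero]
    have e0 : φ (N 0) = functional X φ ν F₀ G₀ := by simp [hN, functional]
    have e1 : φ (N 1) = functional X φ ν F₁ G₁ := by simp [hN, functional]
    rw [e0, e1]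
    exact hneε.symm
  have hprod : deriv φ (N t) * ∫ x in X, fderiv ℝ ν ((1 - t) * F₀ x + t * F₁ x,
      (1 - t) * G₀ x + t * G₁ x) (u x, v x) ≠ 0 := by
    rw [hteq]
    simpa using hne'
  -- The two mixtures commute: the point on the segment is again a mixture with the uniform density.
  have hro : ∀ {f₀ f₁ : E d → ℝ}, f₀ ∈ densityClass X s L B' B → f₁ ∈ densityClass X s L B' B →
      ∃ η, IsRoomy X s L B' B η (fun x => (1 - t) * ((1 - ε) * f₀ x + ε * unif X) +
        t * ((1 - ε) * f₁ x + ε * unif X)) := by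
    intro f₀ f₁ h₀ h₁
    obtain ⟨η, h⟩ := exists_isRoomy hX hXi hL
      (densityClass_combo hX (a := 1 - t) (b := t) (by linarith [ht.2]) ht.1.le (by ring) h₀ h₁)
      hε0 hε1
    refine ⟨η, ?_⟩
    convert h using 2
    ring
  obtain ⟨η₁, hη₁⟩ := hro hf₀ hf₁
  obtain ⟨η₂, hη₂⟩ := hro hg₀ hg₁
  have hint : ∀ {F₀ F₁ : E d → ℝ}, F₀ ∈ densityClass X s L B' B → F₁ ∈ densityClass X s L B' B →
      ∫ x in X, (F₁ x - F₀ x) = 0 := by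
    intro F₀ F₁ h₀ h₁
    rw [integral_sub (h₁.1.1.integrableOn_compact hX) (h₀.1.1.integrableOn_compact hX),
      h₁.2.2.2, h₀.2.2.2, sub_self]
  exact ⟨_, _, u, v, min η₁ η₂, min t (1 - t),
    hη₁.mono (lt_min hη₁.pos hη₂.pos) (min_le_left _ _),
    hη₂.mono (lt_min hη₁.pos hη₂.pos) (min_le_right _ _), huc, hvc, hint mF₀ mF₁,
    hint mG₀ mG₁, lt_min ht.1 (by linarith [ht.2]), hline t ht, left_ne_zero_of_mul hprod,
    right_ne_zero_of_mul hprod⟩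

/-! ### The lower bound of parametric order -/

/-- For two mean-zero perturbations of a density, the linear terms of the mixed second moment
vanish. -/
theorem integral_add_mul_add_div (hX : IsCompact X) {f Γ Γ' : E d → ℝ} (hf : ContinuousOn f X)
    (hΓ : ContinuousOn Γ X) (hΓ' : ContinuousOn Γ' X) (hpos : ∀ x ∈ X, 0 < f x)
    (hf1 : ∫ x in X, f x = 1) (h0 : ∫ x in X, Γ x = 0) (h0' : ∫ x in X, Γ' x = 0) :
    ∫ x in X, (f x + Γ x) * (f x + Γ' x) / f x = 1 + ∫ x in X, Γ x * Γ' x / f x := by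
  have hc : ContinuousOn (fun x => Γ x * Γ' x / f x) X :=
    (hΓ.mul hΓ').div hf fun x hx => (hpos x hx).ne'
  have e : ∫ x in X, (f x + Γ x) * (f x + Γ' x) / f x =
      ∫ x in X, (f x + Γ x + (Γ' x + Γ x * Γ' x / f x)) := by
    refine setIntegral_congr_fun hX.measurableSet fun x hx => ?_
    have := (hpos x hx).ne'
    field_simp
  have i1 := hf.integrableOn_compact (μ := volume) hX
  have i2 := hΓ.integrableOn_compact (μ := volume) hX
  have i3 := hΓ'.integrableOn_compact (μ := volume) hX
  have i4 := hc.integrableOn_compact (μ := volume) hX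
  have i5 : IntegrableOn (fun x => f x + Γ x) X := i1.add i2
  have i6 : IntegrableOn (fun x => Γ' x + Γ x * Γ' x / f x) X := i3.add i4
  rw [e, integral_add i5 i6, integral_add i1 i2, integral_add i3 i4, hf1, h0, h0']
  ring

theorem one_add_pow_le_exp {x : ℝ} (hx : 0 ≤ 1 + x) (n : ℕ) : (1 + x) ^ n ≤ Real.exp (n * x) := by
  rw [Real.exp_nat_mul]
  gcongr
  linarith [Real.add_one_le_exp x]

/-- The mixed second moment of the likelihood ratios of two perturbations `a Γ` and `a Γ'` of `f`,
for a sample of size `n`, is at most exponential in `n a²` times the inner product of `Γ` and `Γ'`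
in `L²(1 / f)`. -/
theorem integral_pow_le_exp (hX : IsCompact X) {f Γ Γ' : E d → ℝ} (a : ℝ)
    (hf : f ∈ densityClass X s L B' B) (hpos : ∀ x ∈ X, 0 < f x)
    (hΓ : ContinuousOn Γ X) (hΓ' : ContinuousOn Γ' X) (h0 : ∫ x in X, Γ x = 0)
    (h0' : ∫ x in X, Γ' x = 0) (hF : ∀ x ∈ X, 0 ≤ f x + a * Γ x)
    (hF' : ∀ x ∈ X, 0 ≤ f x + a * Γ' x) (n : ℕ) :
    (∫ x in X, (f x + a * Γ x) * (f x + a * Γ' x) / f x) ^ n ≤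
      Real.exp (n * a ^ 2 * ∫ x in X, Γ x * Γ' x * (f x)⁻¹) := by
  have hnn : 0 ≤ ∫ x in X, (f x + a * Γ x) * (f x + a * Γ' x) / f x :=
    setIntegral_nonneg hX.measurableSet fun x hx =>
      div_nonneg (mul_nonneg (hF x hx) (hF' x hx)) (hpos x hx).le
  have hc : ∀ {Γ : E d → ℝ}, ContinuousOn Γ X → ContinuousOn (fun x => a * Γ x) X := fun h =>
    continuousOn_const.mul h
  rw [integral_add_mul_add_div hX hf.1.1 (hc hΓ) (hc hΓ')
    hpos hf.2.2.2 (by rw [integral_const_mul, h0, mul_zero])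
    (by rw [integral_const_mul, h0', mul_zero])] at hnn ⊢
  refine (one_add_pow_le_exp hnn n).trans (le_of_eq ?_)
  have e : ∫ x in X, a * Γ x * (a * Γ' x) / f x = a ^ 2 * ∫ x in X, Γ x * Γ' x * (f x)⁻¹ := by
    rw [← integral_const_mul]
    congr 1
    funext x
    ring
  rw [e, mul_assoc]

theorem exists_sign_mul_eq_abs (a : ℝ) : ∃ σ : ℝ, σ ^ 2 = 1 ∧ |σ| = 1 ∧ σ * a = |a| := by
  rcases le_total 0 a with h | h
  · exact ⟨1, by norm_num, by norm_num, by rw [one_mul, abs_of_nonneg h]⟩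
  · exact ⟨-1, by norm_num, by norm_num, by rw [abs_of_nonpos h]; ring⟩

/-- The bound of parametric order: two pairs at distance of order `n^(-1/2)` along a direction in
which the functional has a nonzero derivative cannot be told apart. -/
theorem exists_parametric_le_minimaxRisk (hX : IsCompact X) {ν : ℝ × ℝ → ℝ}
    (hν : ContDiffOn ℝ 2 ν (openInterval B' B ×ˢ openInterval B' B))
    {φ : ℝ → ℝ} {U : Set ℝ} (hU : IsOpen U) (hφ : ContDiffOn ℝ 2 φ U)
    (hνU : ∀ f ∈ densityClass X s L B' B, ∀ g ∈ densityClass X s L B' B,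
      (∫ x in X, ν (f x, g x)) ∈ U)
    {f g u v : E d → ℝ} {η τ : ℝ} (hf : IsRoomy X s L B' B η f) (hg : IsRoomy X s L B' B η g)
    (hu : ContinuousOn u X) (hv : ContinuousOn v X) (hu0 : ∫ x in X, u x = 0)
    (hv0 : ∫ x in X, v x = 0) (hτ : 0 < τ)
    (hline : ∀ t : ℝ, |t| ≤ τ → (fun x => f x + t * u x) ∈ densityClass X s L B' B ∧
      (fun x => g x + t * v x) ∈ densityClass X s L B' B)
    (hφ' : deriv φ (∫ x in X, ν (f x, g x)) ≠ 0)
    (hν' : ∫ x in X, fderiv ℝ ν (f x, g x) (u x, v x) ≠ 0) (K : ℝ) (hK : 0 < K) :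
    ∃ c : ℝ, 0 < c ∧ ∀ᶠ n : ℕ in atTop, ∀ m : ℕ, (m : ℝ) ≤ K * n →
      ENNReal.ofReal (c * (n : ℝ)⁻¹) ≤ minimaxRisk X s L B' B φ ν n m := by
  have hη := hf.pos
  have hfpos : ∀ x ∈ X, 0 < f x := fun x hx => hη.trans_le (hf.le x hx)
  have hgpos : ∀ x ∈ X, 0 < g x := fun x hx => hη.trans_le (hg.le x hx)
  set T : ℝ → ℝ := fun t => functional X φ ν (fun x => f x + t * u x) (fun x => g x + t * v x)
    with hT
  set T' : ℝ := deriv φ (∫ x in X, ν (f x, g x)) * ∫ x in X, fderiv ℝ ν (f x, g x) (u x, v x)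
    with hT'
  have hT'0 : T' ≠ 0 := mul_ne_zero hφ' hν'
  have hT0 : T 0 = functional X φ ν f g := by simp [hT]
  have hTd : HasDerivAt T T' 0 := by
    have h1 := hasDerivAt_integral_line hX (isOpen_openInterval B' B) hν hf.mem.1.1 hg.mem.1.1
      hu hv hτ fun t ht x hx => ⟨(hline t ht).1.2.1 x hx, (hline t ht).2.2.1 x hx⟩
    have h2 := hasDerivAt_of_contDiffOn hU hφ (hνU f hf.mem g hg.mem)
    refine HasDerivAt.comp (h₂ := φ) 0 ?_ h1
    simpa using h2
  -- To first order `T h - T 0` is `T' * h`.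
  have hlin : ∀ᶠ h in 𝓝 (0 : ℝ), |T h - T 0 - T' * h| ≤ |T'| / 2 * |h| := by
    have h1 := hTd.isLittleO.def (c := |T'| / 2) (by positivity)
    filter_upwards [h1] with h hh
    simpa [mul_comm h T'] using hh
  set C : ℝ := ∫ x in X, u x * u x * (f x)⁻¹ with hC
  set C' : ℝ := ∫ x in X, v x * v x * (g x)⁻¹ with hC'
  have hC'0 : 0 ≤ C' := setIntegral_nonneg hX.measurableSet fun x hx =>
    mul_nonneg (mul_self_nonneg _) (inv_pos.2 (hgpos x hx)).le
  set A : ℝ := Real.exp (C + K * C') with hA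
  have hA0 : 0 < A := Real.exp_pos _
  have htend : Tendsto (fun n : ℕ => (Real.sqrt n)⁻¹) atTop (𝓝 0) :=
    (tendsto_natCast_atTop_atTop.comp tendsto_id |> Real.tendsto_sqrt_atTop.comp).inv_tendsto_atTop
  refine ⟨3 * (|T'| / 2) ^ 2 / (16 * (1 + A)), by positivity, ?_⟩
  filter_upwards [htend.eventually hlin, htend.eventually (Metric.closedBall_mem_nhds 0 hτ),
    eventually_gt_atTop 0] with n hn1 hn2 hn3 m hm
  set h : ℝ := (Real.sqrt n)⁻¹ with hh
  have hnpos : (0 : ℝ) < n := by exact_mod_cast hn3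
  have hhpos : 0 < h := by positivity
  have hh2 : h ^ 2 = (n : ℝ)⁻¹ := by rw [hh, inv_pow, Real.sq_sqrt hnpos.le]
  have hhτ : |h| ≤ τ := by simpa [Real.dist_eq] using hn2
  obtain ⟨σ, hσ, hσ1, hσT⟩ := exists_sign_mul_eq_abs T'
  have key := le_minimaxRisk_of_mixture (φ := φ) (ν := ν) (n := n) (m := m) (Λ := Unit) hX hf.mem
    hg.mem
    (F := fun _ x => f x + h * u x) (G := fun _ x => g x + h * v x) (fun _ => (hline h hhτ).1)
    (fun _ => (hline h hhτ).2) hfpos hgpos hA0 (δ := |T'| / 2 * h) (σ := σ) ?_ (by positivity) hσ ?_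
  · refine le_trans (ENNReal.ofReal_le_ofReal (le_of_eq ?_)) key
    rw [mul_pow, hh2]
    ring
  · simp only [Finset.univ_unique, Finset.sum_singleton, Fintype.card_unique, Nat.cast_one,
      one_pow, mul_one]
    have hFm := (hline h hhτ).1.2.2.1
    have hGm := (hline h hhτ).2.2.2.1
    calc _ ≤ Real.exp (n * h ^ 2 * C) * Real.exp (m * h ^ 2 * C') :=
          mul_le_mul (integral_pow_le_exp hX h hf.mem hfpos hu hu hu0 hu0 hFm hFm n)
            (integral_pow_le_exp hX h hg.mem hgpos hv hv hv0 hv0 hGm hGm m)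
            (pow_nonneg (setIntegral_nonneg hX.measurableSet fun x hx =>
              div_nonneg (mul_self_nonneg _) (hgpos x hx).le) _) (Real.exp_pos _).le
      _ ≤ A := by
        rw [← Real.exp_add, hA, Real.exp_le_exp, hh2]
        have e1 : (n : ℝ) * (n : ℝ)⁻¹ * C = C := by field_simp
        have e2 : (m : ℝ) * (n : ℝ)⁻¹ * C' ≤ K * C' := by
          calc (m : ℝ) * (n : ℝ)⁻¹ * C' ≤ (K * n) * (n : ℝ)⁻¹ * C' := by gcongr
            _ = K * C' := by field_simp
        linarith
  · intro _
    have h1 : |σ * (T h - T 0 - T' * h)| ≤ |T'| / 2 * h := by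
      rw [abs_mul, hσ1, one_mul]
      simpa [abs_of_pos hhpos] using hn1
    have h2 := (abs_le.1 h1).1
    have h3 : σ * (T h - T 0) = σ * (T h - T 0 - T' * h) + σ * T' * h := by ring
    have h4 : |T'| / 2 * h ≤ σ * (T h - T 0) := by rw [h3, hσT]; linarith
    rwa [hT0] at h4

/-! ### A point of nonvanishing curvature -/

/-- If the Hessian of `ν` vanished near every value of `(f, g)`, the gradient of `ν` along
`(f, g)` would be constant, since the interior of `X` is connected, and the derivative of the
functional in mass-preserving directions would be zero. The point of nonvanishing Hessian need not
itself be a value of `(f, g)`, but can be taken arbitrarily close to the value at `x₀`. -/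
theorem exists_mem_interior_hessian_ne_zero (hX : IsCompact X) (hXcl : closure (interior X) = X)
    (hXc : IsConnected (interior X)) {I : Set ℝ} (hI : IsOpen I) {ν : ℝ × ℝ → ℝ}
    (hν : ContDiffOn ℝ 2 ν (I ×ˢ I)) {f g u v : E d → ℝ} (hf : ContinuousOn f X)
    (hg : ContinuousOn g X) (hu : ContinuousOn u X) (hv : ContinuousOn v X)
    (hfI : ∀ x ∈ X, f x ∈ I) (hgI : ∀ x ∈ X, g x ∈ I)
    (hu0 : ∫ x in X, u x = 0) (hv0 : ∫ x in X, v x = 0)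
    (hν' : ∫ x in X, fderiv ℝ ν (f x, g x) (u x, v x) ≠ 0) :
    ∃ x₀ ∈ interior X, ∀ V ∈ 𝓝 (f x₀, g x₀), ∃ z ∈ V, z ∈ I ×ˢ I ∧
      fderiv ℝ (fderiv ℝ ν) z ≠ 0 := by
  by_contra hcon
  push Not at hcon
  have hO : IsOpen (I ×ˢ I) := hI.prod hI
  have hfd : ContDiffOn ℝ 1 (fderiv ℝ ν) (I ×ˢ I) := hν.fderiv_of_isOpen hO (by norm_num)
  have hfg : ContinuousOn (fun x => (f x, g x)) X := hf.prodMk hg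
  set G : E d → (ℝ × ℝ →L[ℝ] ℝ) := fun x => fderiv ℝ ν (f x, g x) with hG
  have hGc : ContinuousOn G X := hfd.continuousOn.comp hfg fun x hx => ⟨hfI x hx, hgI x hx⟩
  have hloc : ∀ x₀ ∈ interior X, ∀ᶠ x in 𝓝 x₀, G x = G x₀ := by
    intro x₀ hx₀
    obtain ⟨V, hV, hV0⟩ := hcon x₀ hx₀
    have hz : (f x₀, g x₀) ∈ I ×ˢ I := ⟨hfI _ (interior_subset hx₀), hgI _ (interior_subset hx₀)⟩
    obtain ⟨r, hr, hball⟩ := Metric.mem_nhds_iff.1 (Filter.inter_mem hV (hO.mem_nhds hz))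
    have hx : ContinuousAt (fun x => (f x, g x)) x₀ :=
      hfg.continuousAt (mem_interior_iff_mem_nhds.1 hx₀)
    filter_upwards [hx.eventually (Metric.ball_mem_nhds _ hr)] with x hxx
    refine Metric.isOpen_ball.is_const_of_fderiv_eq_zero
      (convex_ball (f x₀, g x₀) r).isPreconnected
      ((hfd.differentiableOn one_ne_zero).mono fun z hz => (hball hz).2)
      (fun z hz => hV0 z (hball hz).1 (hball hz).2) hxx (Metric.mem_ball_self hr)
  obtain ⟨x₁, hx₁⟩ := hXc.nonempty
  have hconst : Set.EqOn G (fun _ => G x₁) (interior X) := by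
    intro x hx
    have hl : IsLocallyConstant (fun y : interior X => G y) := by
      rw [IsLocallyConstant.iff_eventually_eq]
      intro y
      exact continuousAt_subtype_val.eventually (hloc y y.2)
    have : PreconnectedSpace (interior X) := Subtype.preconnectedSpace hXc.isPreconnected
    exact hl.apply_eq_of_isPreconnected isPreconnected_univ (x := ⟨x, hx⟩) (y := ⟨x₁, hx₁⟩)
      trivial trivial
  have hconstX : Set.EqOn G (fun _ => G x₁) X :=
    hconst.of_subset_closure hGc continuousOn_const interior_subset hXcl.ge
  apply hν'
  have e : ∀ x ∈ X, fderiv ℝ ν (f x, g x) (u x, v x) =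
      G x₁ (1, 0) * u x + G x₁ (0, 1) * v x := by
    intro x hx
    have h1 : fderiv ℝ ν (f x, g x) = G x₁ := hconstX hx
    have h2 : ((u x, v x) : ℝ × ℝ) = u x • (1, 0) + v x • (0, 1) := by simp
    rw [h1, h2, map_add, map_smul, map_smul, smul_eq_mul, smul_eq_mul]
    ring
  rw [setIntegral_congr_fun hX.measurableSet e,
    integral_add ((hu.integrableOn_compact hX).const_mul _)
      ((hv.integrableOn_compact hX).const_mul _), integral_const_mul,
    integral_const_mul, hu0, hv0]
  simp

/-- By polarization, a symmetric bilinear form that vanishes on the diagonal is zero. -/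
theorem exists_hessian_apply_self_ne_zero {ν : ℝ × ℝ → ℝ} {z : ℝ × ℝ} (hν : ContDiffAt ℝ 2 ν z)
    (h : fderiv ℝ (fderiv ℝ ν) z ≠ 0) : ∃ w : ℝ × ℝ, fderiv ℝ (fderiv ℝ ν) z w w ≠ 0 := by
  by_contra hcon
  push Not at hcon
  have hsymm : IsSymmSndFDerivAt ℝ ν z := hν.isSymmSndFDerivAt (by simp)
  refine h (ContinuousLinearMap.ext fun a => ContinuousLinearMap.ext fun b => ?_)
  have h1 := hcon (a + b)
  have h2 := hsymm.eq a b
  simp only [map_add, add_apply, hcon a, hcon b] at h1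
  simp only [zero_apply]
  linarith

/-- The difference of two bumps has vanishing integral and is positive at a prescribed interior
point. -/
theorem exists_isPerturbation_ne_zero (hd : 0 < d) (hs : 0 < s) {x₀ : E d} (hx₀ : x₀ ∈ interior X)
    {η : ℝ} (hη : 0 < η) : ∃ Γ : E d → ℝ, IsPerturbation X s η Γ ∧ 0 < Γ x₀ := by
  obtain ⟨ε₀, hε₀, hpert⟩ := exists_isPerturbation_bumps d s hs
  obtain ⟨ρ, hρ, hball⟩ := Metric.isOpen_iff.1 isOpen_interior x₀ hx₀
  set r : ℝ := min (ρ / 5) 1 with hr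
  have hr0 : 0 < r := by positivity
  have hr1 : r ≤ 1 := min_le_right _ _
  have hrρ : 5 * r ≤ ρ := by linarith [min_le_left (ρ / 5) 1]
  set e : E d := EuclideanSpace.single (⟨0, hd⟩ : Fin d) (1 : ℝ) with he
  have hen : ‖e‖ = 1 := by simp [he]
  set q : E d := x₀ + (3 * r) • e with hq
  have hdist : dist x₀ q = 3 * r := by
    rw [hq, dist_self_add_right, norm_smul, hen, mul_one, Real.norm_eq_abs,
      abs_of_pos (by linarith)]
  have hb1 : Metric.closedBall x₀ r ⊆ X := fun y hy => interior_subset (hball (by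
    rw [Metric.mem_ball]; rw [Metric.mem_closedBall] at hy; linarith))
  have hb2 : Metric.closedBall q r ⊆ X := fun y hy => interior_subset (hball (by
    rw [Metric.mem_ball]; rw [Metric.mem_closedBall] at hy
    have := dist_triangle_right y x₀ q
    linarith))
  have hi : ∀ p : E d, Metric.closedBall p r ⊆ X → IntegrableOn (bumpAt p r) X := by
    intro p _
    have h0 := (contDiff_bumpAt p r (n := 0)).continuous
    have h1 : HasCompactSupport (bumpAt p r) := by
      refine HasCompactSupport.intro (isCompact_closedBall p r) fun x hx => bumpAt_eq_zero hr0 ?_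
      rw [Metric.mem_closedBall] at hx
      exact not_le.1 hx
    exact (h0.integrable_of_hasCompactSupport h1).integrableOn
  have hΓ := hpert X Bool (fun b => if b then x₀ else q) (fun b => if b then 1 else -1) r η hr0 hr1
    hη.le ?_ ?_ ?_
  · refine ⟨_, hΓ, ?_⟩
    have : bumpAt q r x₀ = 0 := bumpAt_eq_zero hr0 (by rw [hdist]; linarith)
    simp only [Fintype.sum_bool, if_true, Bool.false_eq_true, if_false, this, bumpAt_self]
    have : 0 < r ^ s := by positivity
    simp only [mul_one, mul_zero, add_zero]
    positivity
  · intro i j hij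
    cases i <;> cases j <;> simp_all [dist_comm]
    · linarith
    · linarith
  · intro b
    cases b <;> simp
  · simp only [Fintype.sum_bool, if_true, Bool.false_eq_true, if_false, one_mul, neg_one_mul,
      ← sub_eq_add_neg]
    rw [integral_sub (hi _ hb1) (hi _ hb2),
      setIntegral_comp_bumpAt hr0 hb1 (fun t => t) rfl,
      setIntegral_comp_bumpAt hr0 hb2 (fun t => t) rfl, sub_self]

/-- A pair of roomy densities whose values at some interior point are a point of nonvanishing
Hessian of `ν`, and at which the outer function has a nonzero derivative. It is obtained from a
pair with nonzero derivative by a small perturbation that moves the values at one point to a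
prescribed place. -/
theorem exists_isRoomy_hessian_ne_zero (hd : 0 < d) (hs : 0 < s) (hX : IsCompact X)
    (hXcl : closure (interior X) = X)
    (hXc : IsConnected (interior X)) {ν : ℝ × ℝ → ℝ}
    (hν : ContDiffOn ℝ 2 ν (openInterval B' B ×ˢ openInterval B' B))
    {φ : ℝ → ℝ} {U : Set ℝ} (hU : IsOpen U) (hφ : ContDiffOn ℝ 2 φ U)
    (hνU : ∀ f ∈ densityClass X s L B' B, ∀ g ∈ densityClass X s L B' B,
      (∫ x in X, ν (f x, g x)) ∈ U)
    {f g u v : E d → ℝ} {η : ℝ} (hf : IsRoomy X s L B' B η f) (hg : IsRoomy X s L B' B η g)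
    (hu : ContinuousOn u X) (hv : ContinuousOn v X) (hu0 : ∫ x in X, u x = 0)
    (hv0 : ∫ x in X, v x = 0)
    (hφ' : deriv φ (∫ x in X, ν (f x, g x)) ≠ 0)
    (hν' : ∫ x in X, fderiv ℝ ν (f x, g x) (u x, v x) ≠ 0) :
    ∃ (f g : E d → ℝ) (η : ℝ) (x₀ : E d) (w : ℝ × ℝ), IsRoomy X s L B' B η f ∧
      IsRoomy X s L B' B η g ∧ x₀ ∈ interior X ∧ deriv φ (∫ x in X, ν (f x, g x)) ≠ 0 ∧
      fderiv ℝ (fderiv ℝ ν) (f x₀, g x₀) w w ≠ 0 := by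
  have hη := hf.pos
  have hIo := isOpen_openInterval B' B
  obtain ⟨x₀, hx₀, hx₀V⟩ := exists_mem_interior_hessian_ne_zero hX hXcl hXc hIo hν hf.mem.1.1
    hg.mem.1.1 hu hv hf.mem.2.1 hg.mem.2.1 hu0 hv0 hν'
  obtain ⟨Γ, hΓ, hΓ0⟩ := exists_isPerturbation_ne_zero hd hs hx₀ (half_pos hη)
  have hdc : ContinuousAt (deriv φ) (∫ x in X, ν (f x, g x)) :=
    (hφ.continuousOn_deriv_of_isOpen hU (by norm_num)).continuousAt
      (hU.mem_nhds (hνU f hf.mem g hg.mem))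
  obtain ⟨ε, hε, hεφ⟩ := Metric.eventually_nhds_iff.1 (hdc.eventually_ne hφ')
  obtain ⟨δ, hδ, hδN⟩ := exists_abs_integral_sub_le hX hIo hν.continuousOn hf.mem.1.1 hg.mem.1.1
    hf.mem.2.1 hg.mem.2.1 hε
  set r : ℝ := min 1 (δ / η) with hr
  have hr0 : 0 < r := by positivity
  obtain ⟨z, hzV, hzI, hz⟩ := hx₀V _ (Metric.ball_mem_nhds (f x₀, g x₀) (mul_pos hr0 hΓ0))
  rw [Metric.mem_ball, Prod.dist_eq, max_lt_iff, Real.dist_eq, Real.dist_eq] at hzV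
  obtain ⟨w, hw⟩ := exists_hessian_apply_self_ne_zero
    (hν.contDiffAt ((hIo.prod hIo).mem_nhds hzI)) hz
  have hstep : ∀ {f : E d → ℝ} {y : ℝ}, IsRoomy X s L B' B η f → |y - f x₀| < r * Γ x₀ →
      ∃ f' : E d → ℝ, IsRoomy X s L B' B (η / 2) f' ∧ f' x₀ = y ∧ ∀ x ∈ X, |f' x - f x| < δ := by
    intro f y hf hy
    set a : ℝ := (y - f x₀) / Γ x₀ with ha
    have har : |a| < r := by rwa [ha, abs_div, abs_of_pos hΓ0, div_lt_iff₀ hΓ0]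
    have ha1 : |a| ≤ 1 := har.le.trans (min_le_left _ _)
    refine ⟨fun x => f x + a * Γ x, hf.add hX ((hΓ.const_mul a).mono ?_), ?_, fun x _ => ?_⟩
    · exact mul_le_of_le_one_left (half_pos hη).le ha1
    · rw [ha]; field_simp; ring
    · rw [add_sub_cancel_left, abs_mul]
      calc |a| * |Γ x| ≤ |a| * η := by
            gcongr
            exact (hΓ.abs_le x).trans (by linarith)
        _ < r * η := by gcongr
        _ ≤ δ / η * η := by gcongr; exact min_le_right _ _
        _ = δ := by field_simp
  obtain ⟨f', hf', hf'x, hf'd⟩ := hstep hf hzV.1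
  obtain ⟨g', hg', hg'x, hg'd⟩ := hstep hg hzV.2
  refine ⟨f', g', η / 2, x₀, w, hf', hg', hx₀, hεφ ?_, ?_⟩
  · rw [Real.dist_eq]
    exact hδN f' g' hf'.mem.1.1 hg'.mem.1.1 hf'.mem.2.1 hg'.mem.2.1 hf'd hg'd
  · rw [hf'x, hg'x]
    exact hw

/-! ### Taylor bounds, random signs and the grid -/

/-- The lower Taylor bound of second order on `[0, 1]`. -/
theorem half_le_of_le_second_deriv {p p' p'' : ℝ → ℝ} {a : ℝ}
    (hp : ∀ t ∈ Set.Icc (0 : ℝ) 1, HasDerivAt p (p' t) t)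
    (hp' : ∀ t ∈ Set.Icc (0 : ℝ) 1, HasDerivAt p' (p'' t) t)
    (ha : ∀ t ∈ Set.Icc (0 : ℝ) 1, a ≤ p'' t) : a / 2 ≤ p 1 - p 0 - p' 0 := by
  have h0 : (0 : ℝ) ∈ Set.Icc (0 : ℝ) 1 := ⟨le_rfl, zero_le_one⟩
  have h1 : (1 : ℝ) ∈ Set.Icc (0 : ℝ) 1 := ⟨zero_le_one, le_rfl⟩
  have mono : ∀ {k k' : ℝ → ℝ}, (∀ t ∈ Set.Icc (0 : ℝ) 1, HasDerivAt k (k' t) t) →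
      (∀ t ∈ Set.Icc (0 : ℝ) 1, 0 ≤ k' t) → MonotoneOn k (Set.Icc 0 1) := by
    intro k k' hk hk'
    refine monotoneOn_of_hasDerivWithinAt_nonneg (f' := k') (convex_Icc 0 1)
      (fun t ht => (hk t ht).continuousAt.continuousWithinAt)
      (fun t ht => (hk t (interior_subset ht)).hasDerivWithinAt)
      (fun t ht => hk' t (interior_subset ht))
  have m1 : MonotoneOn (fun t => p' t - a * t) (Set.Icc 0 1) :=
    mono (k' := fun t => p'' t - a) (fun t ht => by
      have := (hp' t ht).sub ((hasDerivAt_id t).const_mul a)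
      rw [mul_one] at this
      exact this)
      (fun t ht => sub_nonneg.2 (ha t ht))
  have m2 : MonotoneOn (fun t => p t - p' 0 * t - a / 2 * t ^ 2) (Set.Icc 0 1) :=
    mono (k' := fun t => p' t - a * t - p' 0) (fun t ht => by
      have := ((hp t ht).sub ((hasDerivAt_id t).const_mul (p' 0))).sub
        ((hasDerivAt_pow 2 t).const_mul (a / 2))
      refine this.congr_deriv ?_
      norm_num
      ring)
      (fun t ht => by
        have := m1 h0 ht ht.1
        simp only [mul_zero, sub_zero] at this
        linarith)
  have := m2 h0 h1 zero_le_one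
  norm_num at this
  linarith

/-- Second order Taylor bounds along a line, from bounds for the Hessian in its direction. -/
theorem taylor_bounds_line {O V : Set (ℝ × ℝ)} (hO : IsOpen O) {ν : ℝ × ℝ → ℝ}
    (hν : ContDiffOn ℝ 2 ν O) (hVO : V ⊆ O) (hV : Convex ℝ V) {w : ℝ × ℝ} {σ q₀ q₁ : ℝ}
    (hq : ∀ z ∈ V, q₀ ≤ σ * fderiv ℝ (fderiv ℝ ν) z w w ∧ σ * fderiv ℝ (fderiv ℝ ν) z w w ≤ q₁)
    {z : ℝ × ℝ} {t : ℝ} (hz : z ∈ V) (hzt : z + t • w ∈ V) :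
    q₀ / 2 * t ^ 2 ≤ σ * (ν (z + t • w) - ν z - t * fderiv ℝ ν z w) ∧
      σ * (ν (z + t • w) - ν z - t * fderiv ℝ ν z w) ≤ q₁ / 2 * t ^ 2 := by
  have hmem : ∀ r ∈ Set.Icc (0 : ℝ) 1, z + (r * t) • w ∈ V := by
    intro r hr
    have := hV hz hzt (a := 1 - r) (b := r) (by linarith [hr.2]) hr.1 (by ring)
    convert this using 1
    rw [smul_add, ← add_assoc, ← add_smul, smul_smul]
    simp
  have hl : ∀ r : ℝ, HasDerivAt (fun r : ℝ => z + (r * t) • w) (t • w) r := by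
    intro r
    have := (((hasDerivAt_id r).mul_const t).smul_const w).const_add z
    simpa using this
  have hp : ∀ r ∈ Set.Icc (0 : ℝ) 1, HasDerivAt (fun r : ℝ => ν (z + (r * t) • w))
      (t * fderiv ℝ ν (z + (r * t) • w) w) r := by
    intro r hr
    have h1 := ((hν.contDiffAt (hO.mem_nhds (hVO (hmem r hr)))).differentiableAt
      (by norm_num)).hasFDerivAt
    refine (h1.comp_hasDerivAt r (hl r)).congr_deriv ?_
    rw [map_smul, smul_eq_mul]
  have hp' : ∀ r ∈ Set.Icc (0 : ℝ) 1, HasDerivAt (fun r : ℝ => t * fderiv ℝ ν (z + (r * t) • w) w)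
      (t ^ 2 * fderiv ℝ (fderiv ℝ ν) (z + (r * t) • w) w w) r := by
    intro r hr
    have h0 : ContDiffOn ℝ 1 (fderiv ℝ ν) O := hν.fderiv_of_isOpen hO (by norm_num)
    have h1 : HasFDerivAt (fderiv ℝ ν) (fderiv ℝ (fderiv ℝ ν) (z + (r * t) • w))
        (z + (r * t) • w) :=
      ((h0.contDiffAt (hO.mem_nhds (hVO (hmem r hr)))).differentiableAt one_ne_zero).hasFDerivAt
    have h2 := h1.comp_hasDerivAt r (hl r)
    have h3 : HasDerivAt (fun r : ℝ => fderiv ℝ ν (z + (r * t) • w) w)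
        ((fderiv ℝ (fderiv ℝ ν) (z + (r * t) • w) (t • w)) w) r :=
      (ContinuousLinearMap.apply ℝ ℝ w).hasFDerivAt.comp_hasDerivAt r h2
    refine (h3.const_mul t).congr_deriv ?_
    rw [map_smul, smul_apply, smul_eq_mul]
    ring
  constructor
  · have := half_le_of_le_second_deriv (a := t ^ 2 * q₀) (fun r hr => (hp r hr).const_mul σ)
      (fun r hr => (hp' r hr).const_mul σ) (fun r hr => by
        have := mul_le_mul_of_nonneg_left (hq _ (hmem r hr)).1 (sq_nonneg t)
        linarith)
    simp only [one_mul, zero_mul, zero_smul, add_zero] at this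
    linarith
  · have := half_le_of_le_second_deriv (a := -(t ^ 2 * q₁)) (fun r hr => (hp r hr).const_mul (-σ))
      (fun r hr => (hp' r hr).const_mul (-σ)) (fun r hr => by
        have := mul_le_mul_of_nonneg_left (hq _ (hmem r hr)).2 (sq_nonneg t)
        linarith)
    simp only [one_mul, zero_mul, zero_smul, add_zero] at this
    linarith

/-- The sign `1` or `-1` encoded by a Boolean. -/
def sgn (b : Bool) : ℝ := if b then 1 else -1

theorem sgn_mul_self (b : Bool) : sgn b * sgn b = 1 := by cases b <;> norm_num [sgn]

theorem abs_sgn (b : Bool) : |sgn b| = 1 := by cases b <;> norm_num [sgn]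

/-- The exponential moment of a diagonal bilinear form in two independent vectors of random signs:
the products of the signs are again independent signs, with exponential moments `cosh (κ j)`. -/
theorem sum_sum_exp_sgn_le {J : Type*} [Fintype J] [DecidableEq J] (κ : J → ℝ) :
    ∑ l : J → Bool, ∑ l' : J → Bool, Real.exp (∑ j, sgn (l j) * sgn (l' j) * κ j) ≤
      Real.exp ((∑ j, κ j ^ 2) / 2) * (Fintype.card (J → Bool) : ℝ) ^ 2 := by
  have h1 : ∀ l : J → Bool, ∑ l' : J → Bool, Real.exp (∑ j, sgn (l j) * sgn (l' j) * κ j) ≤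
      Real.exp ((∑ j, κ j ^ 2) / 2) * (Fintype.card (J → Bool) : ℝ) := by
    intro l
    have h2 : ∑ l' : J → Bool, Real.exp (∑ j, sgn (l j) * sgn (l' j) * κ j) =
        ∏ j, ∑ b : Bool, Real.exp (sgn (l j) * sgn b * κ j) := by
      rw [Finset.prod_univ_sum, Fintype.piFinset_univ]
      simp_rw [Real.exp_sum]
    have h3 : ∀ j, ∑ b : Bool, Real.exp (sgn (l j) * sgn b * κ j) ≤ 2 * Real.exp (κ j ^ 2 / 2) := by
      intro j
      have h4 : ∑ b : Bool, Real.exp (sgn (l j) * sgn b * κ j) = 2 * Real.cosh (κ j) := by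
        rw [Fintype.sum_bool, Real.cosh_eq]
        cases l j <;> simp [sgn]
        · ring
        · ring
      rw [h4]
      exact mul_le_mul_of_nonneg_left (Real.cosh_le_exp_half_sq _) (by norm_num)
    rw [h2]
    refine (Finset.prod_le_prod (fun j _ => Finset.sum_nonneg fun b _ => (Real.exp_pos _).le)
      fun j _ => h3 j).trans (le_of_eq ?_)
    rw [Finset.prod_mul_distrib, ← Real.exp_sum, Finset.sum_div]
    simp [mul_comm]
  refine (Finset.sum_le_sum fun l _ => h1 l).trans (le_of_eq ?_)
  rw [Finset.sum_const, nsmul_eq_mul, Finset.card_univ]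
  ring

/-- A unit vector of `ℝ³` orthogonal to `(1, 1, 1)` and to a given vector: up to sign the normalized
cross product of the two, unless they are parallel. -/
theorem exists_unit_orthogonal (y : Fin 3 → ℝ) :
    ∃ c : Fin 3 → ℝ, ∑ k, c k = 0 ∧ ∑ k, c k * y k = 0 ∧ ∑ k, c k ^ 2 = 1 := by
  obtain ⟨c, h0, h1, h2⟩ : ∃ c : Fin 3 → ℝ, ∑ k, c k = 0 ∧ ∑ k, c k * y k = 0 ∧
      0 < ∑ k, c k ^ 2 := by
    by_cases h : y 0 = y 1
    · refine ⟨![1, -1, 0], ?_, ?_, ?_⟩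
      · simp [Fin.sum_univ_three]
      · simp [Fin.sum_univ_three, h]
      · simp [Fin.sum_univ_three, one_add_one_eq_two]
    · refine ⟨![y 1 - y 2, y 2 - y 0, y 0 - y 1], ?_, ?_, ?_⟩
      · simp [Fin.sum_univ_three]
      · simp [Fin.sum_univ_three]; ring
      · simp only [Fin.sum_univ_three, Matrix.cons_val]
        have : 0 < (y 0 - y 1) ^ 2 := by
          have := sub_ne_zero.2 h
          positivity
        nlinarith [sq_nonneg (y 1 - y 2), sq_nonneg (y 2 - y 0)]
  refine ⟨fun k => c k / Real.sqrt (∑ k, c k ^ 2), ?_, ?_, ?_⟩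
  · rw [← Finset.sum_div, h0, zero_div]
  · simp_rw [div_mul_eq_mul_div]
    rw [← Finset.sum_div, h1, zero_div]
  · simp_rw [div_pow, Real.sq_sqrt h2.le]
    rw [← Finset.sum_div, div_self h2.ne']

/-- A grid of `N ^ d` triples of points with mutual distances greater than twice the mesh `ρ / N`,
in a ball of radius comparable with `ρ`. -/
theorem exists_grid (hd : 0 < d) (x₀ : E d) {ρ : ℝ} (hρ : 0 < ρ) {N : ℕ} (hN : 0 < N) :
    ∃ p : (Fin d → Fin N) × Fin 3 → E d, (∀ i j, i ≠ j → 2 * (ρ / N) < dist (p i) (p j)) ∧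
      ∀ i, Metric.closedBall (p i) (ρ / N) ⊆ Metric.closedBall x₀ ((9 * d + 1) * ρ) := by
  have hN' : (0 : ℝ) < N := by exact_mod_cast hN
  set r : ℝ := ρ / N with hr
  have hr0 : 0 < r := by positivity
  -- The integer coordinates of the grid point `i`: the points of a triple are next to each other in
  -- the first coordinate direction.
  set q : (Fin d → Fin N) × Fin 3 → Fin d → ℕ := fun i l =>
    3 * (i.1 l : ℕ) + if l = ⟨0, hd⟩ then (i.2 : ℕ) else 0 with hq
  have hqinj : ∀ i j, i ≠ j → ∃ l, q i l ≠ q j l := by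
    intro i j hij
    by_contra hcon
    push Not at hcon
    apply hij
    have h1 : ∀ l, (i.1 l : ℕ) = (j.1 l : ℕ) := by
      intro l
      have := hcon l
      simp only [hq] at this
      split_ifs at this <;> omega
    have h2 : (i.2 : ℕ) = (j.2 : ℕ) := by
      have := hcon ⟨0, hd⟩
      simp only [hq, if_true] at this
      have := h1 ⟨0, hd⟩
      omega
    exact Prod.ext (funext fun l => Fin.ext (h1 l)) (Fin.ext h2)
  have hqle : ∀ i l, (q i l : ℝ) ≤ 3 * N := by
    intro i l
    have : q i l ≤ 3 * N := by
      have h1 := (i.1 l).2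
      have h2 := i.2.2
      simp only [hq]
      split_ifs <;> omega
    exact_mod_cast this
  refine ⟨fun i => x₀ + WithLp.toLp 2 fun l => 3 * r * (q i l : ℝ), fun i j hij => ?_,
    fun i x hx => ?_⟩
  · obtain ⟨l, hl⟩ := hqinj i j hij
    have h1 : (1 : ℝ) ≤ |(q i l : ℝ) - q j l| := by
      have : (1 : ℤ) ≤ |(q i l : ℤ) - q j l| := Int.one_le_abs (by omega)
      exact_mod_cast this
    rw [dist_add_left, dist_eq_norm]
    have h2 := PiLp.norm_apply_le (WithLp.toLp 2 (fun l => 3 * r * (q i l : ℝ)) -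
      WithLp.toLp 2 (fun l => 3 * r * (q j l : ℝ)) : E d) l
    refine lt_of_lt_of_le ?_ h2
    rw [PiLp.sub_apply, Real.norm_eq_abs]
    simp only
    rw [← mul_sub, abs_mul, abs_of_pos (by positivity)]
    nlinarith
  · rw [Metric.mem_closedBall] at hx ⊢
    refine (dist_triangle _ (x₀ + WithLp.toLp 2 fun l => 3 * r * (q i l : ℝ)) _).trans ?_
    have h1 : dist (x₀ + WithLp.toLp 2 fun l => 3 * r * (q i l : ℝ)) x₀ ≤ 9 * d * ρ := by
      rw [dist_self_add_left, EuclideanSpace.norm_eq, Real.sqrt_le_left (by positivity)]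
      calc ∑ l, ‖3 * r * (q i l : ℝ)‖ ^ 2 ≤ ∑ _l : Fin d, (9 * ρ) ^ 2 := by
            refine Finset.sum_le_sum fun l _ => ?_
            rw [Real.norm_eq_abs, abs_of_nonneg (by positivity)]
            refine pow_le_pow_left₀ (by positivity) ?_ 2
            calc 3 * r * (q i l : ℝ) ≤ 3 * r * (3 * N) := by gcongr; exact hqle i l
              _ = 9 * ρ := by rw [hr]; field_simp; norm_num
        _ = d * (9 * ρ) ^ 2 := by simp
        _ ≤ (9 * d * ρ) ^ 2 := by
            have hd1 : (1 : ℝ) ≤ d := by exact_mod_cast hd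
            have : (d : ℝ) ≤ d ^ 2 := by nlinarith
            calc (d : ℝ) * (9 * ρ) ^ 2 ≤ d ^ 2 * (9 * ρ) ^ 2 := by gcongr
              _ = _ := by ring
    have h2 : r ≤ ρ := by
      rw [hr]
      exact div_le_self hρ.le (by exact_mod_cast hN)
    linarith

/-! ### The hypercube of perturbations -/

/-- A hypercube of `2 ^ (N ^ d)` perturbations, one for each choice of signs on a grid of mesh of
order `1 / N`: they have vanishing integral, also against `ψ`, and their `L²`-products against a
weight are diagonal in the signs. At each grid point three bumps are combined, with coefficients
orthogonal both to the constants and to the integrals of the bumps against `ψ`. -/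
theorem exists_hypercube (hd : 0 < d) (hs : 0 < s) (hX : IsCompact X) {x₀ : E d} {ρ : ℝ}
    (hρ : 0 < ρ) (hball : Metric.closedBall x₀ ρ ⊆ X) {η : ℝ} (hη : 0 < η) {ψ : E d → ℝ}
    (hψ : ContinuousOn ψ X) :
    ∃ C : ℝ, 0 < C ∧ ∀ N : ℕ, 0 < N → ∃ Γ : ((Fin d → Fin N) → Bool) → E d → ℝ,
      (∀ l, IsPerturbation X s η (Γ l)) ∧
      (∀ l, ∀ x ∉ Metric.closedBall x₀ ρ, Γ l x = 0) ∧
      (∀ l, ∫ x in X, Γ l x * ψ x = 0) ∧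
      (∀ l, ∫ x in X, Γ l x ^ 2 = C * (N : ℝ) ^ (-(2 * s))) ∧
      ∀ (ω : E d → ℝ) (M : ℝ), ContinuousOn ω X → (∀ x ∈ X, 0 ≤ ω x) → (∀ x ∈ X, ω x ≤ M) →
        ∃ κ : (Fin d → Fin N) → ℝ,
          (∀ i, |κ i| ≤ M * (C * (N : ℝ) ^ (-(2 * s)) / (N : ℝ) ^ d)) ∧
          ∀ l l', ∫ x in X, Γ l x * Γ l' x * ω x = ∑ i, sgn (l i) * sgn (l' i) * κ i := by
  obtain ⟨ε₀, hε₀, hpert⟩ := exists_isPerturbation_bumps d s hs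
  set H : ℝ := ∫ x, bump d x ^ 2 with hH
  have hH0 : 0 < H := integral_bump_sq_pos
  set ρ' : ℝ := min (ρ / (9 * d + 1)) 1 with hρ'
  have hρ'0 : 0 < ρ' := by positivity
  have hρ'ρ : (9 * d + 1) * ρ' ≤ ρ := by
    calc (9 * d + 1) * ρ' ≤ (9 * d + 1) * (ρ / (9 * d + 1)) := by
          gcongr; exact min_le_left _ _
      _ = ρ := by field_simp
  refine ⟨(ε₀ * η * ρ' ^ s) ^ 2 * ρ' ^ d * H, by positivity, fun N hN => ?_⟩
  set C : ℝ := (ε₀ * η * ρ' ^ s) ^ 2 * ρ' ^ d * H with hC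
  have hN0 : (0 : ℝ) < N := by exact_mod_cast hN
  set r : ℝ := ρ' / N with hr
  have hr0 : 0 < r := by positivity
  have hr1 : r ≤ 1 := (div_le_self hρ'0.le (by exact_mod_cast hN)).trans (min_le_right _ _)
  obtain ⟨p, hpdist, hpball⟩ := exists_grid hd x₀ hρ'0 hN
  have hpX₀ : ∀ a, Metric.closedBall (p a) r ⊆ Metric.closedBall x₀ ρ := fun a =>
    (hpball a).trans (Metric.closedBall_subset_closedBall hρ'ρ)
  have hpX : ∀ a, Metric.closedBall (p a) r ⊆ X := fun a => (hpX₀ a).trans hball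
  set b : (Fin d → Fin N) × Fin 3 → E d → ℝ := fun a => bumpAt (p a) r with hb
  have hbc : ∀ a, Continuous (b a) := fun a => (contDiff_bumpAt (p a) r (n := 0)).continuous
  choose c hc0 hcψ hc1 using fun i : Fin d → Fin N =>
    exists_unit_orthogonal fun k => ∫ x in X, b (i, k) x * ψ x
  set α : ((Fin d → Fin N) → Bool) → (Fin d → Fin N) × Fin 3 → ℝ :=
    fun l a => sgn (l a.1) * c a.1 a.2 with hα
  have hα1 : ∀ l a, |α l a| ≤ 1 := by
    intro l a
    have h1 : c a.1 a.2 ^ 2 ≤ 1 := by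
      rw [← hc1 a.1]
      exact Finset.single_le_sum (f := fun k => c a.1 k ^ 2) (fun k _ => sq_nonneg _)
        (Finset.mem_univ a.2)
    rw [hα, abs_mul, abs_sgn, one_mul]
    exact abs_le_one_iff_mul_self_le_one.2 (by rw [← sq]; exact h1)
  set k₀ : ℝ := ε₀ * η * r ^ s with hk₀
  -- Integrals of a combination of bumps against a weight.
  have hlin : ∀ (l : (Fin d → Fin N) → Bool) (ω : E d → ℝ), ContinuousOn ω X →
      ∫ x in X, (∑ a, α l a * b a x) * ω x =
        ∑ i, sgn (l i) * ∑ k, c i k * ∫ x in X, b (i, k) x * ω x := by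
    intro l ω hω
    have hi : ∀ a, IntegrableOn (fun x => α l a * (b a x * ω x)) X := fun a =>
      (continuousOn_const.mul ((hbc a).continuousOn.mul hω)).integrableOn_compact hX
    simp_rw [Finset.sum_mul, mul_assoc]
    rw [integral_finsetSum _ fun a _ => hi a]
    simp_rw [integral_const_mul]
    rw [Fintype.sum_prod_type]
    refine Finset.sum_congr rfl fun i _ => ?_
    rw [Finset.mul_sum]
    refine Finset.sum_congr rfl fun k _ => ?_
    simp only [hα]
    ring
  -- The bumps have disjoint supports, so that products are diagonal.
  have hsq : ∀ (l l' : (Fin d → Fin N) → Bool) (x : E d),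
      (∑ a, α l a * b a x) * (∑ a, α l' a * b a x) = ∑ a, α l a * α l' a * b a x ^ 2 := by
    intro l l' x
    rw [Finset.sum_mul_sum]
    refine Finset.sum_congr rfl fun a _ => ?_
    rw [Finset.sum_eq_single a]
    · ring
    · intro a' _ haa'
      have := bumpAt_mul_bumpAt_eq_zero hr0 (hpdist a a' haa'.symm) x
      calc α l a * b a x * (α l' a' * b a' x) = α l a * α l' a' * (b a x * b a' x) := by ring
        _ = 0 := by simp only [hb]; rw [this, mul_zero]
    · intro h; exact absurd (Finset.mem_univ a) h
  have hquad : ∀ (l l' : (Fin d → Fin N) → Bool) (ω : E d → ℝ), ContinuousOn ω X →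
      ∫ x in X, (k₀ * ∑ a, α l a * b a x) * (k₀ * ∑ a, α l' a * b a x) * ω x =
        ∑ i, sgn (l i) * sgn (l' i) *
          (k₀ ^ 2 * ∑ k, c i k ^ 2 * ∫ x in X, b (i, k) x ^ 2 * ω x) := by
    intro l l' ω hω
    have e : ∀ x, (k₀ * ∑ a, α l a * b a x) * (k₀ * ∑ a, α l' a * b a x) * ω x =
        ∑ a, k₀ ^ 2 * (α l a * α l' a) * (b a x ^ 2 * ω x) := by
      intro x
      calc _ = k₀ ^ 2 * ((∑ a, α l a * b a x) * ∑ a, α l' a * b a x) * ω x := by ring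
        _ = _ := by
          rw [hsq, Finset.mul_sum, Finset.sum_mul]
          exact Finset.sum_congr rfl fun a _ => by ring
    simp_rw [e]
    have hi : ∀ a, IntegrableOn (fun x => k₀ ^ 2 * (α l a * α l' a) * (b a x ^ 2 * ω x)) X :=
      fun a => (continuousOn_const.mul
        (((hbc a).pow 2).continuousOn.mul hω)).integrableOn_compact hX
    rw [integral_finsetSum _ fun a _ => hi a]
    simp_rw [integral_const_mul]
    rw [Fintype.sum_prod_type]
    refine Finset.sum_congr rfl fun i _ => ?_
    rw [Finset.mul_sum, Finset.mul_sum]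
    refine Finset.sum_congr rfl fun k _ => ?_
    simp only [hα]
    ring
  have hb1 : ∀ a, ∫ x in X, b a x = r ^ d * ∫ x, bump d x := fun a =>
    setIntegral_comp_bumpAt hr0 (hpX a) (fun t => t) rfl
  have hb2 : ∀ a, ∫ x in X, b a x ^ 2 = r ^ d * H := fun a =>
    setIntegral_comp_bumpAt hr0 (hpX a) (fun t => t ^ 2) (by norm_num)
  have hconst : k₀ ^ 2 * (r ^ d * H) = C * (N : ℝ) ^ (-(2 * s)) / (N : ℝ) ^ d := by
    have e1 : r ^ s = ρ' ^ s / (N : ℝ) ^ s := by rw [hr, Real.div_rpow hρ'0.le hN0.le]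
    have e2 : (N : ℝ) ^ (-(2 * s)) = (((N : ℝ) ^ s) ^ 2)⁻¹ := by
      rw [Real.rpow_neg hN0.le, mul_comm, Real.rpow_mul hN0.le]
      norm_cast
    have e3 : r ^ d = ρ' ^ d / (N : ℝ) ^ d := by rw [hr, div_pow]
    rw [hk₀, hC, e1, e2, e3]
    have : (0 : ℝ) < (N : ℝ) ^ s := by positivity
    field_simp
  refine ⟨fun l x => k₀ * ∑ a, α l a * b a x, fun l => ?_, fun l x hx => ?_, fun l => ?_,
    fun l => ?_, fun ω M hω hω0 hωM => ?_⟩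
  · refine hpert X _ p (α l) r η hr0 hr1 hη.le hpdist (hα1 l) ?_
    have := hlin l (fun _ => 1) continuousOn_const
    simp only [mul_one] at this
    simp only [hb] at this hb1
    rw [this]
    refine Finset.sum_eq_zero fun i _ => ?_
    simp_rw [hb1]
    rw [← Finset.sum_mul, hc0, zero_mul, mul_zero]
  · have : ∀ a, b a x = 0 := fun a => bumpAt_eq_zero hr0 (by
      by_contra h
      exact hx (hpX₀ a (not_lt.1 h)))
    simp [this]
  · simp_rw [mul_assoc]
    rw [integral_const_mul, hlin l ψ hψ]
    simp [hcψ]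
  · have := hquad l l (fun _ => 1) continuousOn_const
    simp only [mul_one] at this
    simp_rw [sq, this, sgn_mul_self, hb2, ← Finset.sum_mul, hc1]
    simp only [one_mul, hconst, Finset.sum_const, Finset.card_univ, Fintype.card_pi,
      Fintype.card_fin, Finset.prod_const, nsmul_eq_mul]
    push_cast
    field_simp
  · refine ⟨fun i => k₀ ^ 2 * ∑ k, c i k ^ 2 * ∫ x in X, b (i, k) x ^ 2 * ω x, fun i => ?_,
      fun l l' => hquad l l' ω hω⟩
    have hbω0 : ∀ a, 0 ≤ ∫ x in X, b a x ^ 2 * ω x := fun a =>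
      setIntegral_nonneg hX.measurableSet fun x hx => mul_nonneg (sq_nonneg _) (hω0 x hx)
    have hbω : ∀ a, ∫ x in X, b a x ^ 2 * ω x ≤ M * (r ^ d * H) := by
      intro a
      rw [← hb2 a, ← integral_const_mul]
      refine setIntegral_mono_on
        ((((hbc a).pow 2).continuousOn.mul hω).integrableOn_compact hX)
        ((continuousOn_const.mul ((hbc a).pow 2).continuousOn).integrableOn_compact hX)
        hX.measurableSet fun x hx => ?_
      rw [mul_comm]
      exact mul_le_mul_of_nonneg_right (hωM x hx) (sq_nonneg _)
    rw [abs_of_nonneg (mul_nonneg (sq_nonneg _) (Finset.sum_nonneg fun k _ =>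
      mul_nonneg (sq_nonneg _) (hbω0 _))), ← hconst]
    calc k₀ ^ 2 * ∑ k, c i k ^ 2 * ∫ x in X, b (i, k) x ^ 2 * ω x
        ≤ k₀ ^ 2 * ∑ k, c i k ^ 2 * (M * (r ^ d * H)) := by
          gcongr with k _
          exact hbω _
      _ = M * (k₀ ^ 2 * (r ^ d * H)) := by
          rw [← Finset.sum_mul, hc1]; ring

/-! ### The lower bound of nonparametric order -/

theorem tendsto_ceil_rpow {β : ℝ} (hβ : 0 < β) :
    Tendsto (fun n : ℕ => ⌈(n : ℝ) ^ β⌉₊) atTop atTop :=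
  tendsto_nat_ceil_atTop.comp ((tendsto_rpow_atTop hβ).comp tendsto_natCast_atTop_atTop)

/-- The bound of nonparametric order, from perturbations of both densities by a hypercube of bumps
with random signs, in a direction in which `ν` is curved. -/
theorem exists_nonparametric_le_minimaxRisk (hd : 0 < d) (hs : 0 < s) (hX : IsCompact X)
    {ν : ℝ × ℝ → ℝ} (hν : ContDiffOn ℝ 2 ν (openInterval B' B ×ˢ openInterval B' B))
    {φ : ℝ → ℝ} {U : Set ℝ} (hU : IsOpen U) (hφ : ContDiffOn ℝ 2 φ U)
    (hνU : ∀ f ∈ densityClass X s L B' B, ∀ g ∈ densityClass X s L B' B,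
      (∫ x in X, ν (f x, g x)) ∈ U)
    {f g : E d → ℝ} {η : ℝ} {x₀ : E d} {w : ℝ × ℝ} (hf : IsRoomy X s L B' B η f)
    (hg : IsRoomy X s L B' B η g) (hx₀ : x₀ ∈ interior X)
    (hφ' : deriv φ (∫ x in X, ν (f x, g x)) ≠ 0)
    (hν' : fderiv ℝ (fderiv ℝ ν) (f x₀, g x₀) w w ≠ 0) (K : ℝ) (hK : 0 < K) :
    ∃ c : ℝ, 0 < c ∧ ∀ᶠ n : ℕ in atTop, ∀ m : ℕ, (m : ℝ) ≤ K * n →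
      ENNReal.ofReal (c * (n : ℝ) ^ (-(8 * s / (4 * s + d)))) ≤
        minimaxRisk X s L B' B φ ν n m := by
  have hη := hf.pos
  set I := openInterval B' B with hI
  have hIo : IsOpen I := isOpen_openInterval B' B
  have hO : IsOpen (I ×ˢ I) := hIo.prod hIo
  have hfpos : ∀ x ∈ X, 0 < f x := fun x hx => hη.trans_le (hf.le x hx)
  have hgpos : ∀ x ∈ X, 0 < g x := fun x hx => hη.trans_le (hg.le x hx)
  have hfc := hf.mem.1.1
  have hgc := hg.mem.1.1
  have hx₀X : x₀ ∈ X := interior_subset hx₀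
  set N₀ : ℝ := ∫ x in X, ν (f x, g x) with hN₀
  set D : ℝ := deriv φ N₀ with hD
  obtain ⟨σ, hσ2, hσ1, hσq⟩ := exists_sign_mul_eq_abs (fderiv ℝ (fderiv ℝ ν) (f x₀, g x₀) w w)
  obtain ⟨σ', hσ'2, hσ'1, hσ'D⟩ := exists_sign_mul_eq_abs D
  set q : ℝ := |fderiv ℝ (fderiv ℝ ν) (f x₀, g x₀) w w| with hq
  have hq0 : 0 < q := abs_pos.2 hν'
  have hD0 : 0 < |D| := abs_pos.2 hφ'
  -- A ball of values on which the Hessian in direction `w` is between `q / 2` and `2 * q`.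
  have hfd : ContDiffOn ℝ 1 (fderiv ℝ ν) (I ×ˢ I) := hν.fderiv_of_isOpen hO (by norm_num)
  have hfdd : ContinuousOn (fderiv ℝ (fderiv ℝ ν)) (I ×ˢ I) :=
    hfd.continuousOn_fderiv_of_isOpen hO le_rfl
  have hz₀ : (f x₀, g x₀) ∈ I ×ˢ I := ⟨hf.mem.2.1 x₀ hx₀X, hg.mem.2.1 x₀ hx₀X⟩
  have hQc : ContinuousAt (fun z => σ * fderiv ℝ (fderiv ℝ ν) z w w) (f x₀, g x₀) :=
    continuousAt_const.mul (((hfdd.continuousAt (hO.mem_nhds hz₀)).clm_apply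
      continuousAt_const).clm_apply continuousAt_const)
  have hQ := hQc.eventually (Icc_mem_nhds (a := q / 2) (b := 2 * q)
    (by simp only [hσq]; linarith) (by simp only [hσq]; linarith))
  obtain ⟨ρ₁, hρ₁, hball₁⟩ := Metric.mem_nhds_iff.1 (hQ.and (hO.mem_nhds hz₀))
  set η₁ : ℝ := ρ₁ / 2 with hη₁
  have hη₁0 : 0 < η₁ := half_pos hρ₁
  have hfgc : ContinuousAt (fun x => (f x, g x)) x₀ :=
    (hfc.prodMk hgc).continuousAt (mem_interior_iff_mem_nhds.1 hx₀)
  obtain ⟨ρ, hρ, hballρ⟩ := Metric.nhds_basis_closedBall.mem_iff.1 (Filter.inter_mem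
    (isOpen_interior.mem_nhds hx₀) (hfgc.preimage_mem_nhds (Metric.ball_mem_nhds _ hη₁0)))
  have hballX : Metric.closedBall x₀ ρ ⊆ X := fun x hx => interior_subset (hballρ hx).1
  set W : ℝ := ‖w‖ + 1 with hW
  have hW0 : 0 < W := by positivity
  have hw1 : |w.1| ≤ W := by
    have := norm_fst_le w
    rw [Real.norm_eq_abs] at this
    linarith
  have hw2 : |w.2| ≤ W := by
    have := norm_snd_le w
    rw [Real.norm_eq_abs] at this
    linarith
  set η₀ : ℝ := min η η₁ / W with hη₀
  have hη₀0 : 0 < η₀ := by positivity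
  have hWη : W * η₀ = min η η₁ := by rw [hη₀]; field_simp
  have hψ : ContinuousOn (fun x => fderiv ℝ ν (f x, g x) w) X :=
    (hfd.continuousOn.comp (hfc.prodMk hgc) fun x hx =>
      ⟨hf.mem.2.1 x hx, hg.mem.2.1 x hx⟩).clm_apply continuousOn_const
  obtain ⟨C, hC0, hcube⟩ := exists_hypercube hd hs hX hρ hballX hη₀0 hψ
  -- `φ` is linear up to a factor near `N₀`.
  have hlin : ∀ᶠ y in 𝓝 N₀, |φ y - φ N₀ - D * (y - N₀)| ≤ |D| / 2 * |y - N₀| := by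
    have h1 := (hasDerivAt_of_contDiffOn hU hφ (hνU f hf.mem g hg.mem)).isLittleO.def
      (c := |D| / 2) (by positivity)
    filter_upwards [h1] with y hy
    rw [Real.norm_eq_abs, Real.norm_eq_abs, smul_eq_mul, mul_comm (y - _)] at hy
    exact hy
  obtain ⟨ε, hε, hεφ⟩ := Metric.eventually_nhds_iff.1 hlin
  -- The mesh `1 / N` with `N` of order `n ^ β` makes `n ^ 2 * N ^ (-(4 * s + d))` of constant
  -- order, and this quantity controls the `χ²`-divergence.
  set β : ℝ := 2 / (4 * s + d) with hβ
  have hβ0 : 0 < β := by positivity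
  set C₁ : ℝ := (1 + K) * W ^ 2 * (η⁻¹ * C) with hC₁
  have hC₁0 : 0 < C₁ := by positivity
  set A : ℝ := Real.exp (C₁ ^ 2 / 2) with hA
  have hA0 : 0 < A := Real.exp_pos _
  have htend : Tendsto (fun n : ℕ => q * C * (⌈(n : ℝ) ^ β⌉₊ : ℝ) ^ (-(2 * s))) atTop (𝓝 0) := by
    have h1 := (tendsto_rpow_neg_atTop (y := 2 * s) (by positivity)).comp
      (tendsto_natCast_atTop_atTop.comp (tendsto_ceil_rpow hβ0))
    simpa using h1.const_mul (q * C)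
  refine ⟨3 * (|D| / 2 * (q / 4 * C * 2 ^ (-(2 * s)))) ^ 2 / (16 * (1 + A)), by positivity, ?_⟩
  filter_upwards [htend.eventually (gt_mem_nhds hε), eventually_gt_atTop 0] with n hn1 hn2 m hm
  have hn0 : (0 : ℝ) < n := by exact_mod_cast hn2
  have hn1' : (1 : ℝ) ≤ n := by exact_mod_cast hn2
  set N : ℕ := ⌈(n : ℝ) ^ β⌉₊ with hN
  have hNpos : 0 < N := Nat.ceil_pos.2 (by positivity)
  have hN0 : (0 : ℝ) < N := by exact_mod_cast hNpos
  have hNge : (n : ℝ) ^ β ≤ N := Nat.le_ceil _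
  have hNle : (N : ℝ) ≤ 2 * (n : ℝ) ^ β := by
    have h1 := Nat.ceil_lt_add_one (show 0 ≤ (n : ℝ) ^ β by positivity)
    have h2 : 1 ≤ (n : ℝ) ^ β := Real.one_le_rpow hn1' hβ0.le
    linarith
  obtain ⟨Γ, hΓpert, hΓsupp, hΓψ, hΓsq, hΓω⟩ := hcube N hNpos
  set e : ℝ := C * (N : ℝ) ^ (-(2 * s)) with he
  have he0 : 0 < e := by positivity
  have hpert : ∀ (a : ℝ) l, |a| ≤ W → IsPerturbation X s η (fun x => a * Γ l x) := by
    intro a l ha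
    refine ((hΓpert l).const_mul a).mono ?_
    calc |a| * η₀ ≤ W * η₀ := by gcongr
      _ ≤ η := by rw [hWη]; exact min_le_left _ _
  have hFm : ∀ l, (fun x => f x + w.1 * Γ l x) ∈ densityClass X s L B' B := fun l =>
    hf.add_mem _ (hpert _ l hw1)
  have hGm : ∀ l, (fun x => g x + w.2 * Γ l x) ∈ densityClass X s L B' B := fun l =>
    hg.add_mem _ (hpert _ l hw2)
  have hΓc : ∀ l, ContinuousOn (Γ l) X := fun l => (hΓpert l).contDiff.continuous.continuousOn
  -- The integral of `ν` moves by an amount of order `N ^ (-2 s)`, in the direction `σ`: the first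
  -- order term vanishes because `Γ l` is orthogonal to the derivative of `ν` in direction `w`.
  have hmove : ∀ l, q / 4 * e ≤ σ * ((∫ x in X, ν (f x + w.1 * Γ l x, g x + w.2 * Γ l x)) - N₀) ∧
      σ * ((∫ x in X, ν (f x + w.1 * Γ l x, g x + w.2 * Γ l x)) - N₀) ≤ q * e := by
    intro l
    have hcν : ContinuousOn (fun x => ν (f x + w.1 * Γ l x, g x + w.2 * Γ l x)) X :=
      hν.continuousOn.comp ((hFm l).1.1.prodMk (hGm l).1.1)
        fun x hx => ⟨(hFm l).2.1 x hx, (hGm l).2.1 x hx⟩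
    have hcν₀ : ContinuousOn (fun x => ν (f x, g x)) X :=
      hν.continuousOn.comp (hfc.prodMk hgc) fun x hx => ⟨hf.mem.2.1 x hx, hg.mem.2.1 x hx⟩
    have hcψ : ContinuousOn (fun x => Γ l x * fderiv ℝ ν (f x, g x) w) X := (hΓc l).mul hψ
    have i1 := hcν.integrableOn_compact (μ := volume) hX
    have i2 := hcν₀.integrableOn_compact (μ := volume) hX
    have i3 := hcψ.integrableOn_compact (μ := volume) hX
    have i12 : IntegrableOn (fun x => ν (f x + w.1 * Γ l x, g x + w.2 * Γ l x) - ν (f x, g x)) X :=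
      i1.sub i2
    have hsqi : ∀ b : ℝ, IntegrableOn (fun x => b * Γ l x ^ 2) X := fun b =>
      (continuousOn_const.mul ((hΓc l).pow 2)).integrableOn_compact hX
    have hrem : ∫ x in X, σ * (ν (f x + w.1 * Γ l x, g x + w.2 * Γ l x) - ν (f x, g x) -
        Γ l x * fderiv ℝ ν (f x, g x) w) =
        σ * ((∫ x in X, ν (f x + w.1 * Γ l x, g x + w.2 * Γ l x)) - N₀) := by
      rw [integral_const_mul, integral_sub i12 i3, integral_sub i1 i2, hΓψ l, sub_zero]
    have hremi : IntegrableOn (fun x => σ * (ν (f x + w.1 * Γ l x, g x + w.2 * Γ l x) -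
        ν (f x, g x) - Γ l x * fderiv ℝ ν (f x, g x) w)) X := (i12.sub i3).const_mul σ
    have hpt : ∀ x ∈ X, q / 2 / 2 * Γ l x ^ 2 ≤ σ * (ν (f x + w.1 * Γ l x, g x + w.2 * Γ l x) -
        ν (f x, g x) - Γ l x * fderiv ℝ ν (f x, g x) w) ∧
        σ * (ν (f x + w.1 * Γ l x, g x + w.2 * Γ l x) -
        ν (f x, g x) - Γ l x * fderiv ℝ ν (f x, g x) w) ≤ 2 * q / 2 * Γ l x ^ 2 := by
      intro x _
      by_cases hx : x ∈ Metric.closedBall x₀ ρ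
      · have hzx : dist (f x, g x) (f x₀, g x₀) < η₁ := (hballρ hx).2
        have hstep : ‖Γ l x • w‖ ≤ η₁ := by
          rw [norm_smul, Real.norm_eq_abs]
          calc |Γ l x| * ‖w‖ ≤ η₀ * W := by
                gcongr
                · exact (hΓpert l).abs_le x
                · linarith
            _ ≤ η₁ := by rw [mul_comm, hWη]; exact min_le_right _ _
        have hsplit : ((f x + w.1 * Γ l x, g x + w.2 * Γ l x) : ℝ × ℝ) =
            (f x, g x) + Γ l x • w := by
          ext <;> simp [mul_comm]
        rw [hsplit]
        refine taylor_bounds_line hO hν (V := Metric.ball (f x₀, g x₀) ρ₁)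
          (fun z hz => (hball₁ hz).2) (convex_ball _ _) (fun z hz => (hball₁ hz).1) ?_ ?_
        · rw [Metric.mem_ball]; linarith
        · rw [Metric.mem_ball]
          refine (dist_triangle _ (f x, g x) _).trans_lt ?_
          rw [dist_self_add_left]
          linarith
      · simp [hΓsupp l x hx]
    constructor
    · have := setIntegral_mono_on (hsqi (q / 2 / 2)) hremi hX.measurableSet fun x hx => (hpt x hx).1
      rw [hrem, integral_const_mul, hΓsq l] at this
      linarith
    · have := setIntegral_mono_on hremi (hsqi (2 * q / 2)) hX.measurableSet fun x hx => (hpt x hx).2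
      rw [hrem, integral_const_mul, hΓsq l] at this
      linarith
  -- The exponents in the mixed second moments are diagonal bilinear forms `κ` in the signs.
  obtain ⟨κf, hκf, hκf'⟩ := hΓω (fun x => (f x)⁻¹) η⁻¹ (hfc.inv₀ fun x hx => (hfpos x hx).ne')
    (fun x hx => (inv_pos.2 (hfpos x hx)).le) (fun x hx => inv_anti₀ hη (hf.le x hx))
  obtain ⟨κg, hκg, hκg'⟩ := hΓω (fun x => (g x)⁻¹) η⁻¹ (hgc.inv₀ fun x hx => (hgpos x hx).ne')
    (fun x hx => (inv_pos.2 (hgpos x hx)).le) (fun x hx => inv_anti₀ hη (hg.le x hx))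
  set κ : (Fin d → Fin N) → ℝ := fun i => n * w.1 ^ 2 * κf i + m * w.2 ^ 2 * κg i with hκ
  have hκle : ∀ i, |κ i| ≤ C₁ * (n * (N : ℝ) ^ (-(2 * s)) / (N : ℝ) ^ d) := by
    intro i
    have hw1' : w.1 ^ 2 ≤ W ^ 2 := by rw [← sq_abs]; gcongr
    have hw2' : w.2 ^ 2 ≤ W ^ 2 := by rw [← sq_abs]; gcongr
    calc |κ i| ≤ |n * w.1 ^ 2 * κf i| + |m * w.2 ^ 2 * κg i| := abs_add_le _ _
      _ = n * w.1 ^ 2 * |κf i| + m * w.2 ^ 2 * |κg i| := by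
          have h1 : (0 : ℝ) ≤ n * w.1 ^ 2 := by positivity
          have h2 : (0 : ℝ) ≤ m * w.2 ^ 2 := by positivity
          rw [abs_mul, abs_mul (m * w.2 ^ 2), abs_of_nonneg h1, abs_of_nonneg h2]
      _ ≤ n * W ^ 2 * (η⁻¹ * (e / (N : ℝ) ^ d)) + K * n * W ^ 2 * (η⁻¹ * (e / (N : ℝ) ^ d)) := by
          gcongr
          · exact hκf i
          · exact hκg i
      _ = C₁ * (n * (N : ℝ) ^ (-(2 * s)) / (N : ℝ) ^ d) := by rw [hC₁, he]; ring
  have hκsum : ∑ i, κ i ^ 2 ≤ C₁ ^ 2 := by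
    have hNpow : (n : ℝ) ^ 2 * ((N : ℝ) ^ (-(2 * s))) ^ 2 ≤ (N : ℝ) ^ d := by
      have h1 : (n : ℝ) ^ 2 ≤ (N : ℝ) ^ (4 * s + d) := by
        calc (n : ℝ) ^ 2 = ((n : ℝ) ^ β) ^ (4 * s + d) := by
              rw [← Real.rpow_mul hn0.le, hβ, div_mul_cancel₀ _ (by positivity)]
              norm_cast
          _ ≤ (N : ℝ) ^ (4 * s + d) := by gcongr
      have h2 : ((N : ℝ) ^ (-(2 * s))) ^ 2 = (N : ℝ) ^ (-(4 * s)) := by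
        rw [← Real.rpow_natCast, ← Real.rpow_mul hN0.le]
        congr 1
        push_cast
        ring
      rw [h2]
      calc (n : ℝ) ^ 2 * (N : ℝ) ^ (-(4 * s)) ≤ (N : ℝ) ^ (4 * s + d) * (N : ℝ) ^ (-(4 * s)) := by
            gcongr
        _ = (N : ℝ) ^ d := by
            rw [← Real.rpow_add hN0, ← Real.rpow_natCast]
            congr 1
            ring
    calc ∑ i, κ i ^ 2 ≤ ∑ _i : Fin d → Fin N,
          (C₁ * (n * (N : ℝ) ^ (-(2 * s)) / (N : ℝ) ^ d)) ^ 2 := by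
          refine Finset.sum_le_sum fun i _ => ?_
          rw [← sq_abs]
          have := hκle i
          gcongr
      _ = C₁ ^ 2 * ((n : ℝ) ^ 2 * ((N : ℝ) ^ (-(2 * s))) ^ 2 / (N : ℝ) ^ d) := by
          simp only [Finset.sum_const, Finset.card_univ, Fintype.card_pi, Fintype.card_fin,
            Finset.prod_const, nsmul_eq_mul]
          push_cast
          field_simp
      _ ≤ C₁ ^ 2 * 1 := by
          gcongr
          rw [div_le_one (by positivity)]
          exact hNpow
      _ = C₁ ^ 2 := mul_one _
  have hkey := le_minimaxRisk_of_mixture (φ := φ) (ν := ν) (n := n) (m := m)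
    (Λ := (Fin d → Fin N) → Bool) hX hf.mem hg.mem
    (F := fun l x => f x + w.1 * Γ l x) (G := fun l x => g x + w.2 * Γ l x) hFm hGm hfpos hgpos
    hA0 (δ := |D| / 2 * (q / 4 * e)) (σ := σ * σ') ?_ (by positivity)
    (by rw [mul_pow, hσ2, hσ'2, one_mul]) ?_
  · refine le_trans (ENNReal.ofReal_le_ofReal ?_) hkey
    have h1 : (2 : ℝ) ^ (-(2 * s)) * (n : ℝ) ^ (-(2 * s * β)) ≤ (N : ℝ) ^ (-(2 * s)) := by
      calc (2 : ℝ) ^ (-(2 * s)) * (n : ℝ) ^ (-(2 * s * β)) = (2 * (n : ℝ) ^ β) ^ (-(2 * s)) := by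
            rw [Real.mul_rpow (by norm_num) (by positivity), ← Real.rpow_mul hn0.le]
            congr 2
            ring
        _ ≤ (N : ℝ) ^ (-(2 * s)) :=
            Real.rpow_le_rpow_of_nonpos hN0 hNle (by linarith)
    have h2 : (n : ℝ) ^ (-(8 * s / (4 * s + d))) = ((n : ℝ) ^ (-(2 * s * β))) ^ 2 := by
      rw [← Real.rpow_natCast, ← Real.rpow_mul hn0.le]
      congr 1
      rw [hβ]
      push_cast
      ring
    rw [h2, div_mul_eq_mul_div]
    gcongr ?_ / _
    calc 3 * (|D| / 2 * (q / 4 * C * 2 ^ (-(2 * s)))) ^ 2 * ((n : ℝ) ^ (-(2 * s * β))) ^ 2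
        = 3 * (|D| / 2 * (q / 4 *
            (C * ((2 : ℝ) ^ (-(2 * s)) * (n : ℝ) ^ (-(2 * s * β)))))) ^ 2 := by ring
      _ ≤ 3 * (|D| / 2 * (q / 4 * e)) ^ 2 := by
          have := mul_le_mul_of_nonneg_left h1 hC0.le
          gcongr
  · calc ∑ l, ∑ l', (∫ x in X, (f x + w.1 * Γ l x) * (f x + w.1 * Γ l' x) / f x) ^ n *
          (∫ x in X, (g x + w.2 * Γ l x) * (g x + w.2 * Γ l' x) / g x) ^ m
        ≤ ∑ l : (Fin d → Fin N) → Bool, ∑ l' : (Fin d → Fin N) → Bool,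
          Real.exp (∑ i, sgn (l i) * sgn (l' i) * κ i) := by
          refine Finset.sum_le_sum fun l _ => Finset.sum_le_sum fun l' _ => ?_
          have h1 := integral_pow_le_exp hX w.1 hf.mem hfpos (hΓc l) (hΓc l')
            (hΓpert l).integral_eq (hΓpert l').integral_eq (hFm l).2.2.1 (hFm l').2.2.1 n
          have h2 := integral_pow_le_exp hX w.2 hg.mem hgpos (hΓc l) (hΓc l')
            (hΓpert l).integral_eq (hΓpert l').integral_eq (hGm l).2.2.1 (hGm l').2.2.1 m
          refine (mul_le_mul h1 h2 (pow_nonneg (setIntegral_nonneg hX.measurableSet fun x hx =>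
            div_nonneg (mul_nonneg ((hGm l).2.2.1 x hx) ((hGm l').2.2.1 x hx)) (hgpos x hx).le) _)
            (Real.exp_pos _).le).trans (le_of_eq ?_)
          rw [← Real.exp_add, hκf', hκg', Finset.mul_sum, Finset.mul_sum, ← Finset.sum_add_distrib]
          congr 1
          refine Finset.sum_congr rfl fun i _ => ?_
          simp only [hκ]
          ring
      _ ≤ Real.exp ((∑ i, κ i ^ 2) / 2) * (Fintype.card ((Fin d → Fin N) → Bool) : ℝ) ^ 2 :=
          sum_sum_exp_sgn_le κ
      _ ≤ A * (Fintype.card ((Fin d → Fin N) → Bool) : ℝ) ^ 2 := by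
          rw [hA]
          gcongr
  · intro l
    set y : ℝ := ∫ x in X, ν (f x + w.1 * Γ l x, g x + w.2 * Γ l x) with hy
    obtain ⟨hm1, hm2⟩ := hmove l
    have hyabs : |y - N₀| = σ * (y - N₀) := by
      have h1 : 0 ≤ σ * (y - N₀) := le_trans (by positivity) hm1
      rw [← abs_of_nonneg h1, abs_mul, hσ1, one_mul]
    have hclose : dist y N₀ < ε := by
      rw [Real.dist_eq, hyabs]
      refine hm2.trans_lt ?_
      rw [he, ← mul_assoc]
      exact hn1
    have h1 := hεφ hclose
    have h2 : |σ * σ' * (φ y - φ N₀ - D * (y - N₀))| ≤ |D| / 2 * |y - N₀| := by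
      rw [abs_mul, abs_mul, hσ1, hσ'1, one_mul, one_mul]
      exact h1
    have h3 := (abs_le.1 h2).1
    have h4 : σ * σ' * (φ y - φ N₀) = σ * σ' * (φ y - φ N₀ - D * (y - N₀)) +
        σ' * D * (σ * (y - N₀)) := by ring
    have h5 : |D| / 2 * (q / 4 * e) ≤ |D| / 2 * (σ * (y - N₀)) := by gcongr
    change |D| / 2 * (q / 4 * e) ≤ σ * σ' * (φ y - φ N₀)
    rw [h4, hσ'D]
    rw [hyabs] at h3
    linarith

/-! ### The lower bound at the minimax rate -/

lemma rateExponent_pos (hs : 0 < s) : 0 < rateExponent d s := by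
  unfold rateExponent
  have : (0 : ℝ) ≤ d := Nat.cast_nonneg d
  exact lt_min (by positivity) one_pos

/-- The lower bound at rate `n ^ (-τ)`, as long as `m` is at most of order `n`. If `8 s < 4 s + d`
then `d > 0`, and the nonparametric bound applies; otherwise `τ = 1` and the parametric one does. -/
theorem exists_rate_le_minimaxRisk (hX : IsCompact X) (hXcl : closure (interior X) = X)
    (hXc : IsConnected (interior X)) (hs : 0 < s) (hL : 0 < L) {ν : ℝ × ℝ → ℝ}
    (hν : ContDiffOn ℝ 2 ν (openInterval B' B ×ˢ openInterval B' B))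
    {φ : ℝ → ℝ} {U : Set ℝ} (hU : IsOpen U) (hφ : ContDiffOn ℝ 2 φ U)
    (hνU : ∀ f ∈ densityClass X s L B' B, ∀ g ∈ densityClass X s L B' B,
      (∫ x in X, ν (f x, g x)) ∈ U)
    (hT : ∃ f₀ ∈ densityClass X s L B' B, ∃ g₀ ∈ densityClass X s L B' B,
      ∃ f₁ ∈ densityClass X s L B' B, ∃ g₁ ∈ densityClass X s L B' B,
        functional X φ ν f₀ g₀ ≠ functional X φ ν f₁ g₁) (K : ℝ) (hK : 0 < K) :
    ∃ c : ℝ, 0 < c ∧ ∀ᶠ n : ℕ in atTop, ∀ m : ℕ, (m : ℝ) ≤ K * n →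
      ENNReal.ofReal (c * (n : ℝ) ^ (-rateExponent d s)) ≤ minimaxRisk X s L B' B φ ν n m := by
  obtain ⟨f, g, u, v, η, τ, hf, hg, hu, hv, hu0, hv0, hτ, hline, hφ', hν'⟩ :=
    exists_isRoomy_derivative_ne_zero hX hXc.nonempty hL hν hU hφ hνU hT
  rcases le_or_gt 1 (8 * s / (4 * s + d)) with h | h
  · rw [show rateExponent d s = 1 from min_eq_right h]
    simp only [Real.rpow_neg_one]
    exact exists_parametric_le_minimaxRisk hX hν hU hφ hνU hf hg hu hv hu0 hv0 hτ hline hφ' hν'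
      K hK
  · rw [show rateExponent d s = 8 * s / (4 * s + d) from min_eq_left h.le]
    have hd : 0 < d := by
      have hd0 : (0 : ℝ) ≤ d := Nat.cast_nonneg d
      rw [div_lt_one (by positivity)] at h
      have : (0 : ℝ) < d := by linarith
      exact_mod_cast this
    obtain ⟨f, g, η, x₀, w, hf, hg, hx₀, hφ', hν'⟩ :=
      exists_isRoomy_hessian_ne_zero hd hs hX hXcl hXc hν hU hφ hνU hf hg hu hv hu0 hv0 hφ' hν'
    exact exists_nonparametric_le_minimaxRisk hd hs hX hν hU hφ hνU hf hg hx₀ hφ' hν' K hK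

/-- If the proportion of the first sample tends to a number strictly between `0` and `1`, the two
sample sizes are comparable, with constants that depend on the limit only. -/
lemma eventually_sample_sizes_comparable {ζ : ℝ} (h₀ : 0 < ζ) (h₁ : ζ < 1) {m : ℕ → ℕ}
    (h : Tendsto (fun n : ℕ => (n : ℝ) / ((n : ℝ) + (m n : ℝ))) atTop (𝓝 ζ)) :
    ∀ᶠ n in atTop, (m n : ℝ) ≤ 2 / ζ * n ∧ (1 - ζ) / 2 * n ≤ m n := by
  filter_upwards [h.eventually (eventually_gt_nhds (half_lt_self h₀)),
    h.eventually (eventually_lt_nhds (show ζ < (1 + ζ) / 2 by linarith)),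
    eventually_gt_atTop 0] with n hn1 hn2 hn
  have hn' : (0 : ℝ) < n := by exact_mod_cast hn
  have hm : (0 : ℝ) ≤ m n := Nat.cast_nonneg _
  rw [lt_div_iff₀ (by positivity)] at hn1
  rw [div_lt_iff₀ (by positivity)] at hn2
  constructor
  · rw [div_mul_eq_mul_div, le_div_iff₀ h₀]
    nlinarith [mul_pos h₀ hn']
  · nlinarith [mul_nonneg (sub_nonneg.2 h₁.le) hm]

end TwoSampleLB

theorem theorem4 {d : ℕ} (X : Set (TwoSampleLB.E d)) (hX : IsCompact X)
    (hXcl : closure (interior X) = X) (hXconn : IsConnected (interior X))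
    (s L : ℝ) (hs : 0 < s) (hL : 0 < L) (B' B : EReal)
    (ν : ℝ × ℝ → ℝ)
    (hν : ContDiffOn ℝ 2 ν
      (TwoSampleLB.openInterval B' B ×ˢ TwoSampleLB.openInterval B' B))
    (φ : ℝ → ℝ) (U : Set ℝ) (hU : IsOpen U) (hφ : ContDiffOn ℝ 2 φ U)
    (hνU : ∀ f ∈ TwoSampleLB.densityClass X s L B' B,
      ∀ g ∈ TwoSampleLB.densityClass X s L B' B, (∫ x in X, ν (f x, g x)) ∈ U)
    (hT : ∃ f₀ ∈ TwoSampleLB.densityClass X s L B' B,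
      ∃ g₀ ∈ TwoSampleLB.densityClass X s L B' B,
      ∃ f₁ ∈ TwoSampleLB.densityClass X s L B' B,
      ∃ g₁ ∈ TwoSampleLB.densityClass X s L B' B,
        TwoSampleLB.functional X φ ν f₀ g₀ ≠ TwoSampleLB.functional X φ ν f₁ g₁)
    (ζ : ℝ) (hζ₀ : 0 < ζ) (hζ₁ : ζ < 1) :
    ∃ c : ℝ, 0 < c ∧ ∀ m : ℕ → ℕ,
      Tendsto (fun n : ℕ => (n : ℝ) / ((n : ℝ) + (m n : ℝ))) atTop (𝓝 ζ) →
      ENNReal.ofReal c ≤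
        liminf (fun n : ℕ =>
          TwoSampleLB.minimaxRisk X s L B' B φ ν n (m n) /
            ENNReal.ofReal ((n : ℝ) ^ (-TwoSampleLB.rateExponent d s) +
              (m n : ℝ) ^ (-TwoSampleLB.rateExponent d s))) atTop := by
  set τ := TwoSampleLB.rateExponent d s with hτ
  have hτ0 : 0 < τ := TwoSampleLB.rateExponent_pos hs
  obtain ⟨c, hc, hrisk⟩ := TwoSampleLB.exists_rate_le_minimaxRisk hX hXcl hXconn hs hL hν hU hφ
    hνU hT (2 / ζ) (by positivity)
  set κ := (1 - ζ) / 2 with hκ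
  have hκ0 : 0 < κ := by rw [hκ]; linarith
  have hκτ : 0 < κ ^ (-τ) := Real.rpow_pos_of_pos hκ0 _
  refine ⟨c / (1 + κ ^ (-τ)), by positivity, fun m hm => ?_⟩
  refine le_liminf_of_le (by isBoundedDefault) ?_
  filter_upwards [hrisk, TwoSampleLB.eventually_sample_sizes_comparable hζ₀ hζ₁ hm,
    eventually_gt_atTop 0] with n hn hmn hn0
  have hn0' : (0 : ℝ) < n := by exact_mod_cast hn0
  have hnτ : 0 < (n : ℝ) ^ (-τ) := Real.rpow_pos_of_pos hn0' _
  have hmτ : (m n : ℝ) ^ (-τ) ≤ κ ^ (-τ) * (n : ℝ) ^ (-τ) := by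
    rw [← Real.mul_rpow hκ0.le hn0'.le]
    exact Real.rpow_le_rpow_of_nonpos (by positivity) hmn.2 (by linarith)
  have hmτ0 : 0 ≤ (m n : ℝ) ^ (-τ) := Real.rpow_nonneg (Nat.cast_nonneg _) _
  have hpos : 0 < (n : ℝ) ^ (-τ) + (m n : ℝ) ^ (-τ) := by positivity
  rw [ENNReal.le_div_iff_mul_le (Or.inl (ENNReal.ofReal_pos.2 hpos).ne')
    (Or.inl ENNReal.ofReal_ne_top), ← ENNReal.ofReal_mul (by positivity)]
  refine le_trans (ENNReal.ofReal_le_ofReal ?_) (hn (m n) hmn.1)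
  calc c / (1 + κ ^ (-τ)) * ((n : ℝ) ^ (-τ) + (m n : ℝ) ^ (-τ))
      ≤ c / (1 + κ ^ (-τ)) * ((1 + κ ^ (-τ)) * (n : ℝ) ^ (-τ)) := by
        gcongr
        linarith
    _ = c * (n : ℝ) ^ (-τ) := by
        field_simp
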